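/- Let $k$ be a field of characteristic different from $2$ containing an element $i$ with $i^2=-1$ (for instance, any algebraically closed field of characteristic $\neq 2$). In $\mathbb{P}^2_k$, with homogeneous coordinates $[x:y:z]$, fix the line at infinity $z=0$ and the point $A=[0:0:1]$. If two curves $B$ and $C$ have equations $F=0$ and $G=0$, with $F$, $G$ nonzero forms of degrees $d$ and $\delta$, the conchoid $\mathcal{C}_B(C)$ is the divisor of the form $R(F,G)\in k[x,y,z]$, the resultant with respect to $(\lambda,\mu)$ of the two binary forms $F((\mu-\lambda)x,(\mu-\lambda)y,\mu z)$ and $G(\lambda x,\lambda y,\mu z)$, of degrees $d$ and $\delta$ in $(\lambda,\mu)$; iterated conchoids are formed from these equations. For $\rho\in k$, $\rho\ne 0$, let $B_\rho$ be the circle $x^2+y^2-\rho^2z^2=0$ with center $A$ and radius $\rho$. Fix $r\in k$, $r\neq 0$, put $B=B_r$, and let $L_1$, $L_2$ be the lines joining $A$ to the two points $[1:\pm i:0]$ of $B$ at infinity. Let $\delta\ge 1$. Then for a generic curve $C$ of degree $\delta$ (that is, for every nonzero form $G$ of degree $\delta$ outside the zero locus of some nonzero form $\Phi$ in the coefficients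 of $G$, where $\Phi$ depends only on $k,i,r,\delta$) the following hold. 1. The double conchoid $\mathcal{C}_B(\mathcal{C}_B(C))$ is a divisor of degree $16\delta$, and $$\mathcal{C}_B(\mathcal{C}_B(C)) = 2\delta\, B + 3\delta\,(L_1+L_2) + 2\,C + C_2,$$ where $C_2=\mathcal{C}_{B_{2r}}(C)$ is the conchoid of $C$ with respect to the circle with center $A$ and twice the radius of $B$. 2. $C_2$ has degree $4\delta$. 3. $B$, $L_1$, $L_2$, $C$, $C_2$ are irreducible, reduced and pairwise distinct, so they are exactly the irreducible components of the double conchoid, with multiplicities exactly $2\delta$, $3\delta$, $3\delta$, $2$ and $1$. -/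

import Mathlib

open MvPolynomial

noncomputable section

namespace PlaneConchoid

/-- An integral curve in the projective plane over `k`, given by its homogeneous ideal, which is
generated by an irreducible form in the homogeneous coordinates `x = X 0`, `y = X 1`, `z = X 2`.
The line at infinity is `z = 0` and the fixed point `A` is `[0 : 0 : 1]`. -/
@[ext]
structure IntegralCurve (k : Type*) [Field k] where
  ideal : Ideal (MvPolynomial (Fin 3) k)
  exists_form : ∃ (F : MvPolynomial (Fin 3) k) (n : ℕ),
    F.IsHomogeneous n ∧ Irreducible F ∧ ideal = Ideal.span {F}

namespace IntegralCurve

variable {k : Type*} [Field k]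

/-- An equation of the integral curve `E`; it is unique up to a nonzero constant. -/
def form (E : IntegralCurve k) : MvPolynomial (Fin 3) k := E.exists_form.choose

theorem irreducible_form (E : IntegralCurve k) : Irreducible E.form :=
  E.exists_form.choose_spec.choose_spec.2.1

theorem ideal_eq (E : IntegralCurve k) : E.ideal = Ideal.span {E.form} :=
  E.exists_form.choose_spec.choose_spec.2.2

/-- The degree of an integral curve. -/
def degree (E : IntegralCurve k) : ℕ := E.form.totalDegree

/-- The multiplicity of the integral curve `E` in the curve `G = 0`. -/
def mult (E : IntegralCurve k) (G : MvPolynomial (Fin 3) k) : ℕ :=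
  (emultiplicity E.form G).toNat

theorem finite_support_mult (G : MvPolynomial (Fin 3) k) :
    (Function.support fun E : IntegralCurve k => (E.mult G : ℤ)).Finite := by
  classical
  by_cases hG : G = 0
  · subst hG
    have h : (Function.support fun E : IntegralCurve k => (E.mult 0 : ℤ)) = ∅ := by
      ext E
      simp [mult]
    rw [h]
    exact Set.finite_empty
  · have hinj : Function.Injective fun E : IntegralCurve k => Associates.mk E.form := by
      intro E E' h
      have h' : Associated E.form E'.form := Associates.mk_eq_mk_iff_associated.1 h
      ext1
      rw [E.ideal_eq, E'.ideal_eq]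
      exact Ideal.span_singleton_eq_span_singleton.2 h'
    refine Set.Finite.subset
      (((UniqueFactorizationMonoid.factors G).map Associates.mk).toFinset.finite_toSet.preimage
        hinj.injOn) ?_
    intro E hE
    have hdvd : E.form ∣ G := by
      by_contra hnot
      apply hE
      simp [mult, emultiplicity_eq_zero.2 hnot]
    obtain ⟨q, hq, hassoc⟩ :=
      UniqueFactorizationMonoid.exists_mem_factors_of_dvd hG E.irreducible_form hdvd
    simp only [Set.mem_preimage, Finset.mem_coe, Multiset.mem_toFinset, Multiset.mem_map]
    exact ⟨q, hq, (Associates.mk_eq_mk_iff_associated.2 hassoc).symm⟩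

end IntegralCurve

/-- Divisors in the projective plane: finite integral combinations of integral curves. -/
abbrev Divisor (k : Type*) [Field k] := IntegralCurve k →₀ ℤ

namespace Divisor

variable {k : Type*} [Field k]

/-- The degree of a divisor. -/
def degree (D : Divisor k) : ℤ := D.sum fun E m => m * (E.degree : ℤ)

/-- The divisor is a single integral curve, counted once. -/
def IsIntegral (D : Divisor k) : Prop := ∃ E : IntegralCurve k, D = Finsupp.single E 1

end Divisor

/-- The divisor of the curve `G = 0`, where `G` is a nonzero form. -/
def divisor {k : Type*} [Field k] (G : MvPolynomial (Fin 3) k) : Divisor k :=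
  Finsupp.ofSupportFinite (fun E => (E.mult G : ℤ)) (IntegralCurve.finite_support_mult G)

/-- The equation of the conchoid of the curves `F = 0` and `G = 0`, where `F` and `G` are nonzero
forms: the resultant of `F((μ - t) x, (μ - t) y, μ z)` and `G(t x, t y, μ z)`, which are forms of
degrees `deg F` and `deg G` in the variables `t` and `μ`. Here these forms are written with
`μ = 1` as polynomials in `t`, and the resultant is taken with respect to the formal degrees
`deg F` and `deg G`, even if the leading coefficients vanish. -/
def conchoid {k : Type*} [Field k] (F G : MvPolynomial (Fin 3) k) : MvPolynomial (Fin 3) k :=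
  Polynomial.resultant
    (aeval (R := k) ![(1 - Polynomial.X) * Polynomial.C (X 0),
      (1 - Polynomial.X) * Polynomial.C (X 1),
      (Polynomial.C (X 2) : Polynomial (MvPolynomial (Fin 3) k))] F)
    (aeval (R := k) ![Polynomial.X * Polynomial.C (X 0),
      Polynomial.X * Polynomial.C (X 1),
      (Polynomial.C (X 2) : Polynomial (MvPolynomial (Fin 3) k))] G)
    F.totalDegree G.totalDegree

/-- The equation of the circle with center `A` and radius `r`. -/
def circle {k : Type*} [Field k] (r : k) : MvPolynomial (Fin 3) k :=
  X 0 ^ 2 + X 1 ^ 2 - C (r ^ 2) * X 2 ^ 2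

/-- The equation of the line through `A = [0 : 0 : 1]` and the point `[a : b : 0]`. -/
def lineThroughA {k : Type*} [Field k] (a b : k) : MvPolynomial (Fin 3) k :=
  C b * X 0 - C a * X 1

/-- The property `P` holds for the generic plane curve of degree `δ`: outside the zero locus of
some nonzero form `Φ` in the coefficients of the equation `G` of the curve. -/
def ForGenericCurve (k : Type*) [Field k] (δ : ℕ) (P : MvPolynomial (Fin 3) k → Prop) : Prop :=
  ∃ (Φ : MvPolynomial {m : Fin 3 →₀ ℕ // m.degree = δ} k) (e : ℕ),
    Φ ≠ 0 ∧ Φ.IsHomogeneous e ∧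
      ∀ G : MvPolynomial (Fin 3) k, G ≠ 0 → G.IsHomogeneous δ →
        eval (fun m => G.coeff m.1) Φ ≠ 0 → P G

end PlaneConchoid

end

/-! Shifting a point by `r` along its line through `A` is two-valued in the plane, since the
distance to `A` is a square root `s` of x² + y². It becomes single-valued on the double cover s² =
x² + y², a quadric cone. In the coordinates u = x + iy, v = x - iy (`lin`) the cone is parametrized
by u = p², v = q², s = pq, with `p`, `q`, `z` of weights 1, 1, 2, and `sq` is pull-back to it. The
shift s/z ↦ s/z - r acts on polynomials by `mob r`. Shifts compose additively up to powers of `ell`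
and `pq` (`mob_hat`).

Over the cone the quadratic polynomial coming from the circle splits into linear factors, so the
resultant pulls back to `hat r G * hat (-r) G` (`sq_lin_conchoid`). Doing this twice combines the
shifts ±r with ±r: the total shift 0 occurs twice and gives 2C, the total shifts ±2r give C₂. The
extraneous factors `ell (±r)` and `pq` of the shifts give B and the two lines with their
multiplicities (`hat_lin_conchoid`, `conchoid_conchoid`). This identity of forms holds for every
nonzero form `G`.

Genericity is needed only for the components. A dimension count makes `G` irreducible
(`forGenericCurve_irreducible`). Its pull-back `sq G` stays irreducible because `G`, restricted to a
branch line of the cover, is not a constant times a square (`irreducible_sq`,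
`forGenericCurve_ne_sq`). The shift is birational, so `hat r G` is irreducible (`irreducible_hat`).
It differs from its conjugate `hat (-r) G`, so their product descends to an irreducible form
(`irreducible_of_sq_eq`). -/

noncomputable section

namespace PlaneConchoid

/-! ### Weighted homogeneous polynomials and their factors -/

section Weights

variable {σ R : Type*} [CommRing R]

/-- Multiply each variable `X i` by the `w i`-th power of a new variable. -/
def scale (w : σ → ℕ) : MvPolynomial σ R →ₐ[R] Polynomial (MvPolynomial σ R) :=
  aeval fun j => Polynomial.C (X j) * Polynomial.X ^ w j

theorem aeval_smul_of_isWeightedHomogeneous {S : Type*} [CommRing S] [Algebra R S] {w : σ → ℕ}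
    {A : MvPolynomial σ R} {n : ℕ} (hA : IsWeightedHomogeneous w A n) (c : S) (v : σ → S) :
    aeval (fun j => c ^ w j * v j) A = c ^ n * aeval v A := by
  rw [aeval_def, eval₂_eq, aeval_def, eval₂_eq, Finset.mul_sum]
  refine Finset.sum_congr rfl fun m hm => ?_
  have h := hA (mem_support_iff.1 hm)
  rw [Finsupp.weight_apply, Finsupp.sum] at h
  simp_rw [mul_pow, Finset.prod_mul_distrib, ← pow_mul]
  rw [Finset.prod_pow_eq_pow_sum, ← h]
  simp_rw [smul_eq_mul, mul_comm (m _)]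
  ring

theorem scale_of_isWeightedHomogeneous {w : σ → ℕ} {A : MvPolynomial σ R} {n : ℕ}
    (hA : IsWeightedHomogeneous w A n) : scale w A = Polynomial.C A * Polynomial.X ^ n := by
  have h := aeval_smul_of_isWeightedHomogeneous hA
    (Polynomial.X : Polynomial (MvPolynomial σ R)) (fun j => Polynomial.C (X j))
  have h1 : aeval (fun j => Polynomial.C (X j)) A = (Polynomial.C A : Polynomial (MvPolynomial σ R)) := by
    have : (aeval fun j => Polynomial.C (X j)) =
        (Algebra.ofId (MvPolynomial σ R) (Polynomial (MvPolynomial σ R))).restrictScalars R := by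
      ext j; simp [Algebra.ofId_apply]
    rw [this]; rfl
  rw [h1] at h
  rw [scale, mul_comm, ← h]
  simp_rw [mul_comm]

theorem scale_apply (w : σ → ℕ) (A : MvPolynomial σ R) (n : ℕ) :
    (scale w A).coeff n = weightedHomogeneousComponent w n A := by
  classical
  induction A using MvPolynomial.induction_on' with
  | monomial m a =>
    rw [scale_of_isWeightedHomogeneous (isWeightedHomogeneous_monomial w m a rfl),
      Polynomial.coeff_C_mul_X_pow, weightedHomogeneousComponent_of_mem
        ((mem_weightedHomogeneousSubmodule R w _ _).2 (isWeightedHomogeneous_monomial w m a rfl))]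
  | add p q hp hq => simp [hp, hq]

theorem isWeightedHomogeneous_iff_scale {w : σ → ℕ} {A : MvPolynomial σ R} {n : ℕ} :
    IsWeightedHomogeneous w A n ↔ scale w A = Polynomial.C A * Polynomial.X ^ n := by
  refine ⟨scale_of_isWeightedHomogeneous, fun h => ?_⟩
  have h1 := scale_apply w A n
  rw [h, Polynomial.coeff_C_mul_X_pow, if_pos rfl] at h1
  rw [h1]
  exact weightedHomogeneousComponent_isWeightedHomogeneous _ _

theorem scale_injective (w : σ → ℕ) : Function.Injective (scale (R := R) w) := by
  have h : (Polynomial.aeval (1 : MvPolynomial σ R)).toRingHom.comp (scale (R := R) w).toRingHom =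
      RingHom.id _ := by
    apply MvPolynomial.ringHom_ext <;> intro j <;> simp [scale]
  exact Function.LeftInverse.injective (g := Polynomial.aeval (1 : MvPolynomial σ R))
    fun A => congrArg (fun f => f A) h

/-- The factors of a nonzero weighted homogeneous polynomial are weighted homogeneous. -/
theorem exists_isWeightedHomogeneous_of_mul [IsDomain R] {w : σ → ℕ} {A B : MvPolynomial σ R}
    {n : ℕ} (h : IsWeightedHomogeneous w (A * B) n) (h0 : A * B ≠ 0) :
    ∃ a b, a + b = n ∧ IsWeightedHomogeneous w A a ∧ IsWeightedHomogeneous w B b := by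
  have key : ∀ P : Polynomial (MvPolynomial σ R), P.natTrailingDegree = P.natDegree →
      P = Polynomial.C (P.coeff P.natDegree) * Polynomial.X ^ P.natDegree := by
    intro P hP
    ext1 d
    rw [Polynomial.coeff_C_mul_X_pow]
    split_ifs with hd
    · rw [hd]
    · rcases lt_or_gt_of_ne hd with h | h
      · exact Polynomial.coeff_eq_zero_of_lt_natTrailingDegree (hP ▸ h)
      · exact Polynomial.coeff_eq_zero_of_natDegree_lt h
  have one : ∀ P : MvPolynomial σ R, (scale w P).natTrailingDegree = (scale w P).natDegree →
      IsWeightedHomogeneous w P (scale w P).natDegree := by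
    intro P hP
    have h1 := key _ hP
    rw [scale_apply] at h1
    have h2 : scale w (weightedHomogeneousComponent w (scale w P).natDegree P) = scale w P := by
      conv_rhs => rw [h1]
      exact scale_of_isWeightedHomogeneous
        (weightedHomogeneousComponent_isWeightedHomogeneous _ _)
    have h3 := scale_injective w h2
    have h4 := weightedHomogeneousComponent_isWeightedHomogeneous (w := w) (scale w P).natDegree P
    rwa [h3] at h4
  have hA : scale w A ≠ 0 := fun h => left_ne_zero_of_mul h0 (scale_injective w (by simpa using h))
  have hB : scale w B ≠ 0 := fun h => right_ne_zero_of_mul h0 (scale_injective w (by simpa using h))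
  have hAB := scale_of_isWeightedHomogeneous h
  rw [map_mul] at hAB
  -- Degree and trailing degree are both additive and agree on the product, so they agree on each
  -- factor.
  have hd := congrArg Polynomial.natDegree hAB
  have ht := congrArg Polynomial.natTrailingDegree hAB
  rw [Polynomial.natDegree_mul hA hB, Polynomial.natDegree_C_mul_X_pow _ _ h0] at hd
  rw [Polynomial.natTrailingDegree_mul hA hB, Polynomial.C_mul_X_pow_eq_monomial,
    Polynomial.natTrailingDegree_monomial h0] at ht
  have h1 := Polynomial.natTrailingDegree_le_natDegree (scale w A)
  have h2 := Polynomial.natTrailingDegree_le_natDegree (scale w B)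
  exact ⟨_, _, hd, one A (by omega), one B (by omega)⟩

end Weights

/-! ### Dimension count for parametrized families -/

section Dimension

variable {k : Type*} [Field k]

/-- A nonzero form vanishes at the point `P`, whose more than `#I + 1` coordinates are polynomials
in `#I` parameters. -/
theorem exists_isHomogeneous_aeval_eq_zero {I J : Type*} [Fintype I] [Fintype J]
    (P : J → MvPolynomial I k) (h : Fintype.card I + 1 < Fintype.card J) :
    ∃ (Φ : MvPolynomial J k) (e : ℕ), Φ ≠ 0 ∧ Φ.IsHomogeneous e ∧ aeval P Φ = 0 := by
  -- The extra variable T = `X none` parametrizes the cone over `P`. For a relation `Φ` among the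
  -- products `P j * T`, the coefficient of T ^ e says that the component of `Φ` of degree `e`
  -- vanishes at `P`.
  let Q : J → MvPolynomial (Option I) k :=
    fun j => (optionEquivLeft k I).symm (Polynomial.C (P j) * Polynomial.X)
  have hQ : ¬ AlgebraicIndependent k Q := by
    intro hQ
    have h1 := hQ.lift_cardinalMk_le_trdeg
    rw [MvPolynomial.trdeg_of_isDomain] at h1
    simp only [Cardinal.mk_fintype, Fintype.card_option, Cardinal.lift_natCast, Nat.cast_le] at h1
    omega
  rw [algebraicIndependent_iff] at hQ
  push Not at hQ
  obtain ⟨Φ, hΦ, hΦ0⟩ := hQ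
  have h1 : Polynomial.mapAlgHom (aeval P) (scale (fun _ => 1) Φ) =
      (0 : Polynomial (MvPolynomial I k)) := by
    have h2 : (Polynomial.mapAlgHom (aeval P)).comp (scale (fun _ => 1)) =
        ((optionEquivLeft k I).toAlgHom).comp (aeval Q) := by
      apply MvPolynomial.algHom_ext
      intro j
      simp [scale, Q]
    have h3 := congrArg (fun f => f Φ) h2
    simp only [AlgHom.comp_apply, hΦ, map_zero] at h3
    exact h3
  obtain ⟨e, he⟩ : ∃ e, homogeneousComponent e Φ ≠ 0 := by
    by_contra! hcon
    apply hΦ0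
    rw [← sum_homogeneousComponent Φ]
    exact Finset.sum_eq_zero fun e _ => hcon e
  refine ⟨homogeneousComponent e Φ, e, he, homogeneousComponent_isHomogeneous _ _, ?_⟩
  have h2 := congrArg (fun p => Polynomial.coeff p e) h1
  simp only [Polynomial.coe_mapAlgHom, Polynomial.coeff_map, scale_apply, Polynomial.coeff_zero] at h2
  exact h2

end Dimension

/-! ### Combining generic properties -/

namespace ForGenericCurve

variable {k : Type*} [Field k] {δ : ℕ}

theorem mono {P Q : MvPolynomial (Fin 3) k → Prop} (hP : ForGenericCurve k δ P)
    (h : ∀ G : MvPolynomial (Fin 3) k, G ≠ 0 → G.IsHomogeneous δ → P G → Q G) :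
    ForGenericCurve k δ Q := by
  obtain ⟨Φ, e, h0, he, hΦ⟩ := hP
  exact ⟨Φ, e, h0, he, fun G hG0 hG hE => h G hG0 hG (hΦ G hG0 hG hE)⟩

theorem and {P Q : MvPolynomial (Fin 3) k → Prop} (hP : ForGenericCurve k δ P)
    (hQ : ForGenericCurve k δ Q) : ForGenericCurve k δ fun G => P G ∧ Q G := by
  obtain ⟨Φ, e, h0, he, hΦ⟩ := hP
  obtain ⟨Ψ, f, h0', hf, hΨ⟩ := hQ
  refine ⟨Φ * Ψ, e + f, mul_ne_zero h0 h0', he.mul hf, fun G hG0 hG hE => ?_⟩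
  rw [map_mul] at hE
  exact ⟨hΦ G hG0 hG (left_ne_zero_of_mul hE), hΨ G hG0 hG (right_ne_zero_of_mul hE)⟩

theorem forall_lt {P : ℕ → MvPolynomial (Fin 3) k → Prop} (n : ℕ)
    (hP : ∀ a < n, ForGenericCurve k δ (P a)) : ForGenericCurve k δ fun G => ∀ a < n, P a G := by
  induction n with
  | zero => exact ⟨1, 0, one_ne_zero, isHomogeneous_one _ _, fun G _ _ _ a ha => by omega⟩
  | succ n ih =>
    refine ((ih fun a ha => hP a (by omega)).and (hP n (by omega))).mono fun G _ _ h a ha => ?_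
    rcases Nat.lt_succ_iff_lt_or_eq.1 ha with h' | rfl
    · exact h.1 a h'
    · exact h.2

end ForGenericCurve

/-! ### Generic conditions on the coefficients of a form -/

section Generic

variable {k : Type*} [Field k] {δ : ℕ}

instance : Fintype {m : Fin 3 →₀ ℕ // m.degree = δ} :=
  Fintype.ofFinset (Finset.finsuppAntidiag Finset.univ δ) fun m => by
    simp [Finset.mem_finsuppAntidiag, Finsupp.degree_eq_sum]
    rfl

theorem card_degree_eq : Fintype.card {m : Fin 3 →₀ ℕ // m.degree = δ} = (δ + 2).choose 2 := by
  refine (Fintype.card_ofFinset (p := {m : Fin 3 →₀ ℕ | m.degree = δ}) _ _).trans ?_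
  rw [Finset.card_finsuppAntidiag_nat_eq_choose]
  have h : δ + 2 = (3 + δ - 1) := by omega
  rw [Finset.card_univ, Fintype.card_fin, ← h]
  exact Nat.choose_symm_add

theorem sum_monomial_coeff {R : Type*} [CommRing R] {G : MvPolynomial (Fin 3) R}
    (hG : G.IsHomogeneous δ) :
    ∑ m : {m : Fin 3 →₀ ℕ // m.degree = δ}, monomial m.1 (G.coeff m.1) = G := by
  classical
  ext d
  simp only [coeff_sum, coeff_monomial]
  by_cases hd : d.degree = δ
  · rw [Finset.sum_eq_single ⟨d, hd⟩]
    · simp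
    · rintro ⟨m, hm⟩ _ hne
      exact if_neg fun h => hne (Subtype.ext h)
    · simp
  · rw [hG.coeff_eq_zero hd]
    exact Finset.sum_eq_zero fun m _ => if_neg fun h : m.1 = d => hd (by rw [← h]; exact m.2)

/-- Points that depend, up to a factor, on few parameters are not generic. -/
theorem forGenericCurve_of_card {I J : Type*} [Fintype I] [Fintype J]
    (P : J → MvPolynomial I k) (h : Fintype.card I + 1 < Fintype.card J)
    (Λ : J → MvPolynomial {m : Fin 3 →₀ ℕ // m.degree = δ} k) (hΛ : ∀ j, (Λ j).IsHomogeneous 1)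
    (hinj : Function.Injective (aeval Λ : MvPolynomial J k →ₐ[k] _)) :
    ForGenericCurve k δ fun G => ¬ ∃ (c : k) (v : I → k),
      ∀ j, eval (fun m => G.coeff m.1) (Λ j) = c * eval v (P j) := by
  obtain ⟨Φ, e, h0, he, hΦ⟩ := exists_isHomogeneous_aeval_eq_zero P h
  refine ⟨aeval Λ Φ, e, fun h => h0 (hinj (by rw [h, map_zero])), ?_, ?_⟩
  · simpa using he.aeval Λ hΛ
  · rintro G - - hG ⟨c, v, hv⟩
    apply hG
    have h1 : eval (fun m => G.coeff m.1) (aeval Λ Φ) =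
        aeval (fun j => eval (fun m => G.coeff m.1) (Λ j)) Φ := by
      have : (aeval (fun m : {m : Fin 3 →₀ ℕ // m.degree = δ} => G.coeff m.1)).comp (aeval Λ) =
          aeval (fun j => aeval (fun m => G.coeff m.1) (Λ j)) := by
        apply MvPolynomial.algHom_ext
        simp
      simpa [aeval_eq_eval] using congrArg (fun f => f Φ) this
    have h2 : aeval (fun j => eval v (P j)) Φ = 0 := by
      have : (aeval v).comp (aeval P) = aeval (fun j => eval v (P j)) := by
        apply MvPolynomial.algHom_ext
        simp [aeval_eq_eval]
      rw [← this, AlgHom.comp_apply, hΦ, map_zero]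
    have h3 := aeval_smul_of_isWeightedHomogeneous he c (fun j => eval v (P j))
    rw [h2, mul_zero] at h3
    rw [h1, ← h3]
    simp [hv]

theorem forGenericCurve_eval_ne_zero {v : Fin 3 → k} (hv : v ≠ 0) :
    ForGenericCurve k δ fun G => eval v G ≠ 0 := by
  let Φ : MvPolynomial {m : Fin 3 →₀ ℕ // m.degree = δ} k :=
    ∑ m, C (∏ j, v j ^ m.1 j) * X m
  refine ⟨Φ, 1, ?_, IsHomogeneous.sum _ _ _ fun m _ => isHomogeneous_C_mul_X _ _, ?_⟩
  · obtain ⟨j, hj⟩ := Function.ne_iff.1 hv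
    intro h
    -- The test form is `X j ^ δ`, for a coordinate with `v j ≠ 0`.
    have h1 := congrArg (eval fun m => if m = ⟨Finsupp.single j δ, by simp⟩ then 1 else 0) h
    simp only [Φ, map_sum, map_mul, eval_C, eval_X, mul_ite, mul_one, mul_zero, map_zero,
      Finset.sum_ite_eq', Finset.mem_univ, if_true] at h1
    rw [Finset.prod_eq_single j] at h1
    · simp at h1
      exact hj h1.1
    · intro l _ hl
      simp [Finsupp.single_eq_of_ne hl]
    · simp
  · intro G hG0 hG h h'
    apply h
    rw [← sum_monomial_coeff hG, map_sum] at h'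
    simp only [Φ, map_sum, map_mul, eval_C, eval_X]
    rw [← h']
    refine Finset.sum_congr rfl fun m _ => ?_
    rw [eval_monomial, Finsupp.prod_fintype _ _ (by simp), mul_comm]

end Generic

theorem add_add_eq_of_degree {m : Fin 3 →₀ ℕ} {n : ℕ} (hm : m.degree = n) :
    m 0 + m 1 + m 2 = n := by
  rw [← hm, Finsupp.degree_eq_sum, Fin.sum_univ_three]

/-! ### Forms monic in z -/

section MonicForm

variable {R : Type*} [CommRing R]

/-- The form of degree `a`, monic in `X 2`, with the given other coefficients. -/
def monicForm (a : ℕ) (f : {m : {m : Fin 3 →₀ ℕ // m.degree = a} //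
    m ≠ ⟨Finsupp.single 2 a, by simp⟩} → R) : MvPolynomial (Fin 3) R :=
  monomial (Finsupp.single 2 a) 1 + ∑ m, monomial m.1.1 (f m)

theorem eq_monicForm {a : ℕ} {A : MvPolynomial (Fin 3) R} (hA : A.IsHomogeneous a)
    (h : A.coeff (Finsupp.single 2 a) = 1) : A = monicForm a fun m => A.coeff m.1.1 := by
  conv_lhs => rw [← sum_monomial_coeff hA,
    Fintype.sum_eq_add_sum_subtype_ne _ ⟨Finsupp.single 2 a, by simp⟩]
  simp only [monicForm, h]

theorem map_monicForm {S : Type*} [CommRing S] (φ : R →+* S) (a : ℕ) (f : _ → R) :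
    map φ (monicForm a f) = monicForm a fun m => φ (f m) := by
  simp [monicForm, map_monomial]

theorem card_ne_single (a : ℕ) : Fintype.card {m : {m : Fin 3 →₀ ℕ // m.degree = a} //
    m ≠ ⟨Finsupp.single 2 a, by simp⟩} + 1 = (a + 2).choose 2 := by
  rw [Fintype.card_subtype_compl, Fintype.card_subtype_eq, card_degree_eq]
  have : 0 < (a + 2).choose 2 := Nat.choose_pos (by omega)
  omega

theorem coeff_single_eq_eval {a : ℕ} {A : MvPolynomial (Fin 3) R} (hA : A.IsHomogeneous a) :
    A.coeff (Finsupp.single 2 a) = eval ![0, 0, 1] A := by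
  conv_rhs => rw [← sum_monomial_coeff hA]
  rw [map_sum, Finset.sum_eq_single ⟨Finsupp.single 2 a, by simp⟩]
  · simp [eval_monomial]
  · rintro ⟨m, hm⟩ _ hne
    rw [eval_monomial, Finsupp.prod_fintype _ _ (by simp), Fin.prod_univ_three]
    have : m 0 ≠ 0 ∨ m 1 ≠ 0 := by
      by_contra! hcon
      apply hne
      ext j
      have h3 := add_add_eq_of_degree hm
      fin_cases j <;> simp <;> omega
    rcases this with h | h <;> simp [h]
  · simp

end MonicForm

/-! ### Irreducibility of the generic form, and its restriction to a line through A -/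

section GenericIrreducibility

variable {k : Type*} [Field k] {δ : ℕ}

theorem two_mul_choose_two (n : ℕ) : 2 * (n + 2).choose 2 = (n + 2) * (n + 1) := by
  rw [Nat.choose_two_right]
  exact Nat.mul_div_cancel' (Nat.even_mul_pred_self (n + 2)).two_dvd

theorem aeval_X_eq {J : Type*} : (aeval X : MvPolynomial J k →ₐ[k] MvPolynomial J k) =
    AlgHom.id k _ := by
  apply MvPolynomial.algHom_ext; simp

/-- If `G` does not vanish at `A`, both factors can be made monic in z at the cost of one common
scalar. Products of two such factors then depend on too few parameters to fill the space of forms.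
-/
theorem forGenericCurve_ne_mul {a b : ℕ} (ha : 0 < a) (hb : 0 < b) (hab : a + b = δ) :
    ForGenericCurve k δ fun G => ∀ A B : MvPolynomial (Fin 3) k,
      A.IsHomogeneous a → B.IsHomogeneous b → G = A * B → eval ![0, 0, 1] G = 0 := by
  classical
  let I := {m : {m : Fin 3 →₀ ℕ // m.degree = a} // m ≠ ⟨Finsupp.single 2 a, by simp⟩} ⊕
    {m : {m : Fin 3 →₀ ℕ // m.degree = b} // m ≠ ⟨Finsupp.single 2 b, by simp⟩}
  let M : MvPolynomial (Fin 3) (MvPolynomial I k) :=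
    monicForm a (fun m => X (Sum.inl m)) * monicForm b (fun m => X (Sum.inr m))
  -- The two sides differ by exactly `a * b`.
  have hcard : Fintype.card I + 1 < Fintype.card {m : Fin 3 →₀ ℕ // m.degree = δ} := by
    rw [Fintype.card_sum, card_degree_eq]
    have h1 := card_ne_single a
    have h2 := card_ne_single b
    have h3 := two_mul_choose_two a
    have h4 := two_mul_choose_two b
    have h5 := two_mul_choose_two δ
    subst hab
    nlinarith [Nat.mul_le_mul ha hb]
  refine (forGenericCurve_of_card (fun m : {m : Fin 3 →₀ ℕ // m.degree = δ} => M.coeff m.1) hcard X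
    (fun j => isHomogeneous_X _ _) ?_).mono ?_
  · rw [aeval_X_eq]; exact fun _ _ h => h
  · intro G hG0 hG hgen A B hA hB hAB
    by_contra h0
    rw [hAB, map_mul, ← coeff_single_eq_eval hA, ← coeff_single_eq_eval hB] at h0
    have hα := left_ne_zero_of_mul h0
    have hβ := right_ne_zero_of_mul h0
    set α := A.coeff (Finsupp.single 2 a)
    set β := B.coeff (Finsupp.single 2 b)
    have hA' := eq_monicForm (A := C α⁻¹ * A) (hA.C_mul _) (by rw [coeff_C_mul, inv_mul_cancel₀ hα])
    have hB' := eq_monicForm (A := C β⁻¹ * B) (hB.C_mul _) (by rw [coeff_C_mul, inv_mul_cancel₀ hβ])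
    apply hgen
    refine ⟨α * β, Sum.elim (fun m => (C α⁻¹ * A).coeff m.1.1) (fun m => (C β⁻¹ * B).coeff m.1.1),
      fun m => ?_⟩
    have h1 : map (eval (Sum.elim (fun m => (C α⁻¹ * A).coeff m.1.1)
        (fun m => (C β⁻¹ * B).coeff m.1.1))) M = (C α⁻¹ * A) * (C β⁻¹ * B) := by
      conv_rhs => rw [hA', hB']
      simp only [M, map_mul, map_monicForm, eval_X, Sum.elim_inl, Sum.elim_inr]
    rw [← coeff_map, h1, eval_X, ← coeff_C_mul, hAB]
    congr 1
    have h2 : (C α * C α⁻¹ : MvPolynomial (Fin 3) k) = 1 := by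
      rw [← C_mul, mul_inv_cancel₀ hα, C_1]
    have h3 : (C β * C β⁻¹ : MvPolynomial (Fin 3) k) = 1 := by
      rw [← C_mul, mul_inv_cancel₀ hβ, C_1]
    rw [C_mul]
    linear_combination (-(A * B)) * h2 - A * B * C α * C α⁻¹ * h3

/-- The generic curve of positive degree is integral. -/
theorem forGenericCurve_irreducible (hδ : 1 ≤ δ) :
    ForGenericCurve k δ fun G => Irreducible G ∧ eval ![0, 0, 1] G ≠ 0 := by
  have h1 : ForGenericCurve k δ fun G => ∀ a < δ, 0 < a → ∀ A B : MvPolynomial (Fin 3) k,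
      A.IsHomogeneous a → B.IsHomogeneous (δ - a) → G = A * B → eval ![0, 0, 1] G = 0 := by
    refine ForGenericCurve.forall_lt δ fun a ha => ?_
    by_cases h0 : 0 < a
    · exact (forGenericCurve_ne_mul h0 (by omega) (by omega)).mono fun G _ _ h _ => h
    · exact ⟨1, 0, one_ne_zero, isHomogeneous_one _ _, fun G _ _ _ h => absurd h h0⟩
  have h2 : ForGenericCurve k δ fun G => eval ![0, 0, 1] G ≠ 0 :=
    forGenericCurve_eval_ne_zero fun h => by simpa using congrFun h 2
  refine (h1.and h2).mono fun G hG0 hG h => ⟨⟨fun hu => ?_, fun A B hAB => ?_⟩, h.2⟩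
  · have h3 := (isUnit_iff_totalDegree_of_isReduced.1 hu).2
    rw [hG.totalDegree hG0] at h3
    omega
  -- The factors of a form are forms, so only products of forms have to be excluded.
  · obtain ⟨a, b, hab, hA, hB⟩ := exists_isWeightedHomogeneous_of_mul (w := 1) (hAB ▸ hG) (hAB ▸ hG0)
    have hu : ∀ P : MvPolynomial (Fin 3) k, P ≠ 0 → P.IsHomogeneous 0 → IsUnit P := by
      intro P hP0 hP
      rw [isUnit_iff_eq_C_of_isReduced]
      rw [← totalDegree_zero_iff_isHomogeneous, totalDegree_eq_zero_iff_eq_C] at hP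
      exact ⟨_, isUnit_iff_ne_zero.2 fun h => hP0 (by rw [hP, h, C_0]), hP⟩
    rcases Nat.eq_zero_or_pos a with rfl | ha
    · exact Or.inl (hu A (left_ne_zero_of_mul (hAB ▸ hG0)) hA)
    rcases Nat.eq_zero_or_pos b with rfl | hb
    · exact Or.inr (hu B (right_ne_zero_of_mul (hAB ▸ hG0)) hB)
    refine absurd (h.1 a (by omega) ha A B hA ?_ hAB) h.2
    rwa [show δ - a = b by omega]

/-- The coefficient of `T ^ n` in `G (x, y, T)`, as a linear form in the coefficients of `G`. -/
def coeffForm (δ : ℕ) (x y : k) (n : ℕ) : MvPolynomial {m : Fin 3 →₀ ℕ // m.degree = δ} k :=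
  ∑ m, C (if m.1 2 = n then x ^ m.1 0 * y ^ m.1 1 else 0) * X m

theorem eval_coeffForm {G : MvPolynomial (Fin 3) k} (hG : G.IsHomogeneous δ) (x y : k) (n : ℕ) :
    eval (fun m => G.coeff m.1) (coeffForm δ x y n) =
      (aeval ![Polynomial.C x, Polynomial.C y, Polynomial.X] G : Polynomial k).coeff n := by
  conv_rhs => rw [← sum_monomial_coeff hG]
  rw [coeffForm, map_sum, map_sum, Polynomial.finsetSum_coeff]
  refine Finset.sum_congr rfl fun m _ => ?_
  rw [aeval_monomial, Finsupp.prod_fintype _ _ (by simp), Fin.prod_univ_three]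
  have : algebraMap k (Polynomial k) (coeff m.1 G) * (![Polynomial.C x, Polynomial.C y, Polynomial.X] 0 ^ m.1 0 *
      ![Polynomial.C x, Polynomial.C y, Polynomial.X] 1 ^ m.1 1 * ![Polynomial.C x, Polynomial.C y, Polynomial.X] 2 ^ m.1 2) =
      Polynomial.C (coeff m.1 G * (x ^ m.1 0 * y ^ m.1 1)) * Polynomial.X ^ m.1 2 := by
    simp [mul_assoc]
  rw [this, Polynomial.coeff_C_mul_X_pow]
  by_cases h : m.1 2 = n
  · simp [h, mul_comm]
  · simp [h, Ne.symm h]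

/-- A left inverse comes from specializing the coefficients: those of monomials containing y become
0, and that of x ^ (δ - n) z ^ n becomes the `n`-th variable up to the power of `x` that normalizes
it. -/
theorem injective_aeval_coeffForm {x : k} (hx : x ≠ 0) (y : k) : Function.Injective
    (aeval fun n : Fin (δ + 1) => coeffForm δ x y n : MvPolynomial (Fin (δ + 1)) k →ₐ[k] _) := by
  let M : {m : Fin 3 →₀ ℕ // m.degree = δ} → MvPolynomial (Fin (δ + 1)) k := fun m =>
    if m.1 1 = 0 then C (x⁻¹ ^ m.1 0) * X (Fin.ofNat (δ + 1) (m.1 2)) else 0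
  have hM : (aeval M).comp (aeval fun n : Fin (δ + 1) => coeffForm δ x y n) = AlgHom.id k _ := by
    apply MvPolynomial.algHom_ext
    intro n
    have hn := n.2
    have hdeg : (Finsupp.single 0 (δ - n : ℕ) + Finsupp.single 2 (n : ℕ) : Fin 3 →₀ ℕ).degree = δ := by
      rw [map_add, Finsupp.degree_single, Finsupp.degree_single]; omega
    have hC : (C x ^ (δ - n : ℕ) * C (x ^ (δ - n : ℕ))⁻¹ : MvPolynomial (Fin (δ + 1)) k) = 1 := by
      rw [← C_pow, ← C_mul, mul_inv_cancel₀ (pow_ne_zero _ hx), C_1]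
    simp only [AlgHom.comp_apply, aeval_X, coeffForm, map_sum, map_mul, AlgHom.id_apply]
    rw [Finset.sum_eq_single ⟨_, hdeg⟩]
    · simp [M, ← mul_assoc, algebraMap_eq, hC]
    · rintro ⟨m, hm⟩ _ hne
      by_cases h1 : m 2 = n
      · by_cases h2 : m 1 = 0
        · exfalso
          apply hne
          have h3 := add_add_eq_of_degree hm
          ext j
          fin_cases j <;> simp <;> omega
        · simp [M, h2]
      · simp [h1]
    · simp
  exact Function.LeftInverse.injective (g := aeval M) fun A => congrArg (fun f => f A) hM

/-- When `G` does not vanish at `A`, the restriction has degree exactly `δ`. For odd `δ` parity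
excludes squares. For `δ = 2 * n` a monic `w` has `n` parameters, while the square has 2n + 1
coefficients, and n + 1 < 2n + 1. -/
theorem forGenericCurve_ne_sq (hδ : 1 ≤ δ) {x : k} (hx : x ≠ 0) (y : k) :
    ForGenericCurve k δ fun G => ∀ (c : k) (w : Polynomial k),
      aeval ![Polynomial.C x, Polynomial.C y, Polynomial.X] G = Polynomial.C c * w ^ 2 →
        eval ![0, 0, 1] G = 0 := by
  have hdeg : ∀ G : MvPolynomial (Fin 3) k, G.IsHomogeneous δ → eval ![0, 0, 1] G ≠ 0 →
      (aeval ![Polynomial.C x, Polynomial.C y, Polynomial.X] G : Polynomial k).natDegree = δ := by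
    intro G hG h0
    apply Polynomial.natDegree_eq_of_le_of_coeff_ne_zero
    · rw [Polynomial.natDegree_le_iff_coeff_eq_zero]
      intro n hn
      rw [← eval_coeffForm hG, coeffForm, map_sum]
      refine Finset.sum_eq_zero fun m _ => ?_
      have h3 := add_add_eq_of_degree m.2
      rw [if_neg (by omega)]
      simp
    · rw [← eval_coeffForm hG, coeffForm, map_sum, Finset.sum_eq_single ⟨Finsupp.single 2 δ, by simp⟩]
      · rw [← coeff_single_eq_eval hG] at h0
        simpa using h0
      · rintro ⟨m, hm⟩ _ hne
        have h3 := add_add_eq_of_degree hm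
        have : m 2 ≠ δ := fun h => hne (by ext j; fin_cases j <;> simp <;> omega)
        simp [this]
      · simp
  rcases Nat.even_or_odd' δ with ⟨n, hn | hn⟩
  · let W : Polynomial (MvPolynomial (Fin n) k) :=
      Polynomial.X ^ n + ∑ j : Fin n, Polynomial.C (X j) * Polynomial.X ^ (j : ℕ)
    refine (forGenericCurve_of_card (fun j : Fin (δ + 1) => (W ^ 2).coeff j) (by simp; omega)
      (fun j => coeffForm δ x y j)
      (fun j => IsHomogeneous.sum _ _ _ fun m _ => isHomogeneous_C_mul_X _ _)
      (injective_aeval_coeffForm hx y)).mono ?_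
    intro G hG0 hG hgen c w hw
    by_contra h0
    have hd := hdeg G hG h0
    have hw0 : w ≠ 0 := by
      rintro rfl
      rw [hw] at hd
      simp at hd
      omega
    have hc0 : c ≠ 0 := by
      rintro rfl
      rw [hw] at hd
      simp at hd
      omega
    have hlc := Polynomial.leadingCoeff_ne_zero.2 hw0
    rw [hw, Polynomial.natDegree_C_mul hc0, Polynomial.natDegree_pow] at hd
    have hwn : w.natDegree = n := by omega
    have hmon := Polynomial.monic_mul_leadingCoeff_inv hw0
    have hnd : (w * Polynomial.C w.leadingCoeff⁻¹).natDegree = n := by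
      rw [Polynomial.natDegree_mul_C (inv_ne_zero hlc), hwn]
    have hsum := hmon.as_sum
    rw [hnd, Finset.sum_range] at hsum
    set u := w * Polynomial.C w.leadingCoeff⁻¹
    have hu : w = Polynomial.C w.leadingCoeff * u := by
      simp only [u]
      rw [mul_comm w, ← mul_assoc, ← Polynomial.C_mul, mul_inv_cancel₀ hlc, Polynomial.C_1, one_mul]
    apply hgen
    refine ⟨c * w.leadingCoeff ^ 2, fun j => u.coeff j, fun j => ?_⟩
    have hW : W.map (eval fun j : Fin n => u.coeff j) = u := by
      conv_rhs => rw [hsum]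
      simp [W, Polynomial.map_sum]
    rw [eval_coeffForm hG, hw, ← Polynomial.coeff_map, Polynomial.map_pow, hW,
      ← Polynomial.coeff_C_mul]
    congr 1
    conv_lhs => rw [hu]
    simp only [map_mul, map_pow]
    ring
  · refine ⟨1, 0, one_ne_zero, isHomogeneous_one _ _, fun G _ hG _ c w hw => ?_⟩
    by_contra h0
    have hd := hdeg G hG h0
    rw [hw] at hd
    have hc0 : c ≠ 0 := by
      rintro rfl
      simp at hd
      omega
    rw [Polynomial.natDegree_C_mul hc0, Polynomial.natDegree_pow] at hd
    omega

end GenericIrreducibility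

/-! ### Substitution into forms in three variables -/

section Substitution

variable {R S S' : Type*} [CommRing R] [CommRing S] [Algebra R S] [CommRing S'] [Algebra R S']

theorem map_aeval₃ (φ : S →ₐ[R] S') (a b c : S) (G : MvPolynomial (Fin 3) R) :
    φ (aeval ![a, b, c] G) = aeval ![φ a, φ b, φ c] G := by
  rw [comp_aeval_apply]
  congr 2
  funext j
  fin_cases j <;> rfl

theorem aeval_mul₃ {G : MvPolynomial (Fin 3) R} {n : ℕ} (hG : G.IsHomogeneous n) (t a b c : S) :
    aeval ![t * a, t * b, t * c] G = t ^ n * aeval ![a, b, c] G := by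
  rw [← aeval_smul_of_isWeightedHomogeneous hG]
  congr 2
  funext j
  fin_cases j <;> simp

/-- The weights of the homogeneous coordinates `p`, `q`, `z` in which the cone
`s ^ 2 = x ^ 2 + y ^ 2` is given by `s = p q`, `x + i y = p ^ 2`, `x - i y = q ^ 2`. -/
abbrev wt : Fin 3 → ℕ := ![1, 1, 2]

theorem aeval_mul_wt {A : MvPolynomial (Fin 3) R} {n : ℕ} (hA : IsWeightedHomogeneous wt A n)
    (t a b c : S) : aeval ![t * a, t * b, t ^ 2 * c] A = t ^ n * aeval ![a, b, c] A := by
  rw [← aeval_smul_of_isWeightedHomogeneous hA]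
  congr 2
  funext j
  fin_cases j <;> simp

theorem aeval_X₃ (A : MvPolynomial (Fin 3) R) : aeval ![X 0, X 1, X 2] A = A := by
  have : (![X 0, X 1, X 2] : Fin 3 → MvPolynomial (Fin 3) R) = X := by
    funext j; fin_cases j <;> rfl
  rw [this, aeval_X_left_apply]

end Substitution

/-! ### The double cover by the cone and irreducibility of pull-backs -/

section Cone

variable {k : Type*} [Field k]

/-- The substitution of `p ^ 2` and `q ^ 2` for the first two coordinates. -/
def sq : MvPolynomial (Fin 3) k →ₐ[k] MvPolynomial (Fin 3) k := aeval ![X 0 ^ 2, X 1 ^ 2, X 2]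

/-- The sign change of `p`. -/
def flip₀ : MvPolynomial (Fin 3) k →ₐ[k] MvPolynomial (Fin 3) k := aeval ![-X 0, X 1, X 2]

/-- The sign change of `q`. -/
def flip₁ : MvPolynomial (Fin 3) k →ₐ[k] MvPolynomial (Fin 3) k := aeval ![X 0, -X 1, X 2]

/-- Followed by z ↦ z², this substitution becomes `expand 2`. -/
theorem sq_injective : Function.Injective (sq : MvPolynomial (Fin 3) k →ₐ[k] _) := by
  have h : (aeval ![X 0, X 1, X 2 ^ 2]).comp sq =
      (expand 2 : MvPolynomial (Fin 3) k →ₐ[k] MvPolynomial (Fin 3) k) := by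
    apply MvPolynomial.algHom_ext
    intro j
    fin_cases j <;> simp [sq]
  intro A B hAB
  apply expand_injective (R := k) (σ := Fin 3) two_pos
  rw [← h, AlgHom.comp_apply, hAB, AlgHom.comp_apply]

theorem flip₀_flip₀ (A : MvPolynomial (Fin 3) k) : flip₀ (flip₀ A) = A := by
  have h : (flip₀.comp flip₀ : MvPolynomial (Fin 3) k →ₐ[k] _) = AlgHom.id k _ := by
    apply MvPolynomial.algHom_ext
    intro j
    fin_cases j <;> simp [flip₀]
  exact congrArg (fun f => f A) h

theorem flip₀_sq (A : MvPolynomial (Fin 3) k) : flip₀ (sq A) = sq A := by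
  rw [sq, map_aeval₃]; simp [flip₀]

theorem flip₁_sq (A : MvPolynomial (Fin 3) k) : flip₁ (sq A) = sq A := by
  rw [sq, map_aeval₃]; simp [flip₁]

/-- Weighted scaling by -1 changes the signs of `p` and `q` and fixes `z`. So both sign changes
induce the same involution s ↦ -s of the cone. -/
theorem flip₁_eq {A : MvPolynomial (Fin 3) k} {n : ℕ} (hA : IsWeightedHomogeneous wt A n) :
    flip₁ A = (-1) ^ n * flip₀ A := by
  have h := aeval_mul_wt hA (-1) (-X 0 : MvPolynomial (Fin 3) k) (X 1) (X 2)
  rw [flip₁, flip₀, ← h]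
  simp

theorem irreducible_flip₀ {P : MvPolynomial (Fin 3) k} (hP : Irreducible P) :
    Irreducible (flip₀ P) :=
  (MulEquiv.irreducible_iff
    (AlgEquiv.ofAlgHom (flip₀ (k := k)) flip₀ (AlgHom.ext flip₀_flip₀) (AlgHom.ext flip₀_flip₀))).2 hP

theorem flip_monomial (m : Fin 3 →₀ ℕ) (c : k) :
    flip₀ (monomial m c) = monomial m ((-1) ^ m 0 * c) ∧
      flip₁ (monomial m c) = monomial m ((-1) ^ m 1 * c) := by
  have h : ∀ d : k, monomial m d = C d * (X 0 ^ m 0 * X 1 ^ m 1 * X 2 ^ m 2) := by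
    intro d
    rw [monomial_eq, Finsupp.prod_fintype _ _ (by simp), Fin.prod_univ_three]
  rw [h, h, h]
  constructor
  · simp [flip₀, algebraMap_eq]
    rw [neg_pow]; ring
  · simp [flip₁, algebraMap_eq]
    rw [neg_pow]; ring

theorem coeff_flip₀ (A : MvPolynomial (Fin 3) k) (m : Fin 3 →₀ ℕ) :
    (flip₀ A).coeff m = (-1) ^ m 0 * A.coeff m := by
  classical
  induction A using MvPolynomial.induction_on' with
  | monomial d a =>
    rw [(flip_monomial d a).1, coeff_monomial, coeff_monomial]
    split_ifs with h <;> simp [h]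
  | add p q hp hq => simp [hp, hq, mul_add]

theorem coeff_flip₁ (A : MvPolynomial (Fin 3) k) (m : Fin 3 →₀ ℕ) :
    (flip₁ A).coeff m = (-1) ^ m 1 * A.coeff m := by
  classical
  induction A using MvPolynomial.induction_on' with
  | monomial d a =>
    rw [(flip_monomial d a).2, coeff_monomial, coeff_monomial]
    split_ifs with h <;> simp [h]
  | add p q hp hq => simp [hp, hq, mul_add]

theorem eq_zero_of_neg_eq {R : Type*} [CommRing R] [IsDomain R] [Algebra k R] (h2 : (2 : k) ≠ 0)
    {a : R} (h : -a = a) : a = 0 := by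
  have h3 : (2 : R) ≠ 0 := by
    rw [← map_ofNat (algebraMap k R) 2]
    exact (map_ne_zero_iff _ (algebraMap k R).injective).2 h2
  have h4 : (2 : R) * a = 0 := by linear_combination -h
  exact (mul_eq_zero.1 h4).resolve_left h3

/-- The polynomials that are invariant under both sign changes. -/
theorem exists_sq_eq (h2 : (2 : k) ≠ 0) {A : MvPolynomial (Fin 3) k} (h₀ : flip₀ A = A)
    (h₁ : flip₁ A = A) : ∃ B, sq B = A := by
  have heven : ∀ (c : k) (n : ℕ), c ≠ 0 → (-1) ^ n * c = c → Even n := by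
    intro c n hc h
    by_contra hn
    rw [Nat.not_even_iff_odd] at hn
    rw [hn.neg_one_pow, neg_one_mul] at h
    exact hc (eq_zero_of_neg_eq h2 h)
  suffices A ∈ (sq (k := k)).range from this
  rw [A.as_sum]
  refine Subalgebra.sum_mem _ fun m hm => ?_
  rw [mem_support_iff] at hm
  obtain ⟨a, ha⟩ := heven _ (m 0) hm (by rw [← coeff_flip₀, h₀])
  obtain ⟨b, hb⟩ := heven _ (m 1) hm (by rw [← coeff_flip₁, h₁])
  refine ⟨C (A.coeff m) * (X 0 ^ a * X 1 ^ b * X 2 ^ m 2), ?_⟩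
  change sq _ = _
  rw [monomial_eq (s := m), Finsupp.prod_fintype _ _ (by simp), Fin.prod_univ_three, ha, hb]
  simp only [sq, map_mul, map_pow, aeval_X, aeval_C, algebraMap_eq, Matrix.cons_val]
  ring

theorem isWeightedHomogeneous_sq_iff {A : MvPolynomial (Fin 3) k} {n : ℕ} :
    IsWeightedHomogeneous wt (sq A) (2 * n) ↔ A.IsHomogeneous n := by
  -- `D` applies `sq` to the coefficients and squares the scaling variable, because u = p² and v =
  -- q² have weight 2.
  let D : Polynomial (MvPolynomial (Fin 3) k) →ₐ[k] Polynomial (MvPolynomial (Fin 3) k) :=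
    ((Polynomial.expand (MvPolynomial (Fin 3) k) 2).restrictScalars k).comp (Polynomial.mapAlgHom sq)
  have hD : Function.Injective D :=
    (Polynomial.expand_injective two_pos).comp (Polynomial.map_injective _ sq_injective)
  have h : (scale wt).comp sq = D.comp (scale 1) := by
    apply MvPolynomial.algHom_ext
    intro j
    fin_cases j <;> simp [sq, scale, D, mul_pow]
  rw [IsHomogeneous, isWeightedHomogeneous_iff_scale, isWeightedHomogeneous_iff_scale,
    ← hD.eq_iff (a := scale 1 A), show scale wt (sq A) = D (scale 1 A) from congrArg (fun f => f A) h]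
  simp [D, pow_mul]

/-- The quotient of two polynomials invariant under the sign changes is itself invariant, hence a
pull-back. -/
theorem exists_sq_eq_of_dvd (h2 : (2 : k) ≠ 0) {G M : MvPolynomial (Fin 3) k} (hM : M ≠ 0)
    (h : sq M ∣ sq G) : M ∣ G := by
  obtain ⟨Q, hQ⟩ := h
  have hM' : sq M ≠ 0 := (map_ne_zero_iff _ sq_injective).2 hM
  obtain ⟨Q', rfl⟩ := exists_sq_eq h2 (A := Q)
    (mul_left_cancel₀ hM' (by rw [← hQ, ← flip₀_sq M, ← map_mul, ← hQ, flip₀_sq]))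
    (mul_left_cancel₀ hM' (by rw [← hQ, ← flip₁_sq M, ← map_mul, ← hQ, flip₁_sq]))
  exact ⟨Q', sq_injective (by rw [hQ, map_mul])⟩

theorem isUnit_of_isUnit_sq {A : MvPolynomial (Fin 3) k} (h : IsUnit (sq A)) : IsUnit A := by
  obtain ⟨c, hc, h⟩ := isUnit_iff_eq_C_of_isReduced.1 h
  have : A = C c := sq_injective (by rw [h]; simp [sq, algebraMap_eq])
  exact isUnit_iff_eq_C_of_isReduced.2 ⟨c, hc, this⟩

/-- The inverse image of a curve `G = 0` in the cone is irreducible, if the cone ramifies over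
a smooth point of the curve. -/
theorem irreducible_sq (h2 : (2 : k) ≠ 0) {G : MvPolynomial (Fin 3) k} {δ : ℕ}
    (hG : G.IsHomogeneous δ) (hirr : Irreducible G)
    (hx : aeval ![(1 : k), 0, 0] G ≠ 0) (hy : aeval ![(0 : k), 1, 0] G ≠ 0)
    (hsq : ∀ (c : k) (w : Polynomial k),
      aeval ![0, 1, Polynomial.X] G ≠ Polynomial.C c * w ^ 2) : Irreducible (sq G) := by
  have hE0 : sq G ≠ 0 := (map_ne_zero_iff _ sq_injective).2 hirr.ne_zero
  have hP0 : ∀ P, P ∣ sq G → aeval ![(0 : k), 1, 0] P ≠ 0 := by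
    rintro P ⟨Q, hQ⟩ h
    apply hy
    have h1 := congrArg (aeval ![(0 : k), 1, 0]) hQ
    rw [map_mul, h, zero_mul, sq, map_aeval₃] at h1
    simpa using h1
  have hP1 : ∀ P, P ∣ sq G → aeval ![(1 : k), 0, 0] P ≠ 0 := by
    rintro P ⟨Q, hQ⟩ h
    apply hx
    have h1 := congrArg (aeval ![(1 : k), 0, 0]) hQ
    rw [map_mul, h, zero_mul, sq, map_aeval₃] at h1
    simpa using h1
  have hmain : ∀ M, sq M ∣ sq G → ¬ IsUnit (sq M) → Associated (sq G) (sq M) := by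
    intro M hM hu
    have hM0 : M ≠ 0 := by
      rintro rfl
      rw [map_zero, zero_dvd_iff] at hM
      exact hE0 hM
    obtain ⟨Q, rfl⟩ := exists_sq_eq_of_dvd h2 hM0 hM
    rcases hirr.isUnit_or_isUnit rfl with h | h
    · exact absurd (h.map sq) hu
    · rw [map_mul]
      exact associated_mul_unit_left _ _ (h.map sq)
  obtain ⟨P, hP, hPE⟩ := WfDvdMonoid.exists_irreducible_factor
    (fun h => hirr.not_isUnit (isUnit_of_isUnit_sq h)) hE0
  obtain ⟨n, hn⟩ : ∃ n, IsWeightedHomogeneous wt P n := by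
    obtain ⟨Q, hQ⟩ := hPE
    obtain ⟨n, -, -, hn, -⟩ := exists_isWeightedHomogeneous_of_mul (w := wt) (n := 2 * δ)
      (hQ ▸ isWeightedHomogeneous_sq_iff.2 hG) (hQ ▸ hE0)
    exact ⟨n, hn⟩
  have hPE' : flip₀ P ∣ sq G := by
    rw [← flip₀_sq G]
    exact map_dvd flip₀ hPE
  have hprime := hP.prime
  have hprime' := (irreducible_flip₀ hP).prime
  by_cases hflip : P ∣ flip₀ P
  · obtain ⟨u, hu⟩ := hP.associated_of_dvd (irreducible_flip₀ hP) hflip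
    obtain ⟨c, -, hc⟩ := isUnit_iff_eq_C_of_isReduced.1 u.isUnit
    rw [hc] at hu
    -- The point (0, 1, 0) is fixed by `flip₀`, and `P` does not vanish there.
    have hc1 : c = 1 := by
      have h3 := congrArg (aeval ![(0 : k), 1, 0]) hu
      rw [map_mul, flip₀, map_aeval₃] at h3
      exact mul_left_cancel₀ (hP0 P hPE) (by simpa using h3)
    rw [hc1, C_1, mul_one] at hu
    -- Likewise (1, 0, 0) is fixed by `flip₁`, which forces the sign (-1) ^ n to be 1. Then `P` is
    -- itself a pull-back.
    have hu' : flip₁ P = P := by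
      rw [flip₁_eq hn, ← hu]
      have h3 := congrArg (aeval ![(1 : k), 0, 0]) (flip₁_eq hn)
      rw [← hu, flip₁, map_aeval₃, map_mul] at h3
      have h4 : (-1 : k) ^ n = 1 := mul_right_cancel₀ (hP1 P hPE) (by simpa using h3.symm)
      rw [← C_1, ← C_neg, ← C_pow, h4, C_1, one_mul]
    obtain ⟨M, rfl⟩ := exists_sq_eq h2 hu.symm hu'
    exact (hmain M hPE hP.not_isUnit).symm.irreducible hP
  · obtain ⟨Q, hQ⟩ := hPE
    have h1 : flip₀ P ∣ Q := by
      refine (hprime'.dvd_or_dvd (hQ ▸ hPE')).resolve_left fun h => hflip ?_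
      have := map_dvd flip₀ h
      rwa [flip₀_flip₀] at this
    have h2 : P * flip₀ P ∣ sq G := hQ ▸ mul_dvd_mul_left P h1
    -- The product of `P` and its conjugate is invariant, so by irreducibility of `G` it is all of
    -- `sq G` up to a unit.
    obtain ⟨M, hM⟩ : ∃ M, sq M = P * flip₀ P := by
      have h3 : flip₀ (P * flip₀ P) = P * flip₀ P := by rw [map_mul, flip₀_flip₀, mul_comm]
      refine exists_sq_eq ‹_› h3 ?_
      have h4 : IsWeightedHomogeneous wt (flip₀ P) n := by
        intro d hd
        rw [coeff_flip₀] at hd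
        exact hn (right_ne_zero_of_mul hd)
      rw [flip₁_eq (hn.mul h4), h3, ← two_mul, pow_mul]
      simp
    obtain ⟨u, hu⟩ := (hmain M (hM ▸ h2) (fun h => hP.not_isUnit (isUnit_of_mul_isUnit_left (hM ▸ h)))).symm
    obtain ⟨c, -, hc⟩ := isUnit_iff_eq_C_of_isReduced.1 u.isUnit
    rw [hc, hM] at hu
    -- On the ramification line p = 0 the two conjugates coincide, so `G` restricts there to a
    -- constant times a square.
    have h5 := congrArg (aeval ![0, 1, Polynomial.X (R := k)]) hu
    rw [map_mul, map_mul, flip₀, sq, map_aeval₃, map_aeval₃] at h5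
    refine absurd ?_ (hsq c (aeval ![0, 1, Polynomial.X] P))
    simp at h5
    rw [← h5]
    ring

end Cone

theorem aeval_congr₃ {R S : Type*} [CommRing R] [CommRing S] [Algebra R S] {a b c a' b' c' : S}
    {G : MvPolynomial (Fin 3) R} (ha : a = a') (hb : b = b') (hc : c = c') :
    aeval ![a, b, c] G = aeval ![a', b', c'] G := by
  rw [ha, hb, hc]

/-! ### Shifts of the cone and the curves lying over conchoids -/

section Conchoid

variable {k : Type*} [Field k]

/-- The plane section `s - r z` of the cone. -/
def ell (r : k) : MvPolynomial (Fin 3) k := X 0 * X 1 - C r * X 2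

/-- The birational map of the cone that adds `r` to the distance from `A`. -/
def mob (r : k) : MvPolynomial (Fin 3) k →ₐ[k] MvPolynomial (Fin 3) k :=
  aeval ![ell r * X 0, ell r * X 1, ell r * (X 0 * X 1) * X 2]

/-- The curve in the cone whose image in the plane is the conchoid of `G = 0` with respect to the
circle of radius `r`. -/
def hat (r : k) (G : MvPolynomial (Fin 3) k) : MvPolynomial (Fin 3) k :=
  aeval ![ell r * X 0 ^ 2, ell r * X 1 ^ 2, X 0 * X 1 * X 2] G

theorem mob_ell (r r' : k) : mob r (ell r') = ell r * (X 0 * X 1) * ell (r + r') := by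
  simp only [ell, mob, map_sub, map_mul, aeval_X, aeval_C, algebraMap_eq, Matrix.cons_val, C_add]
  ring

/-- The shifts by `r` and `-r` are inverse to each other: their composite is weighted scaling by (pq
· `ell r`)². -/
theorem mob_mob {A : MvPolynomial (Fin 3) k} {n : ℕ} (hA : IsWeightedHomogeneous wt A n) (r : k) :
    mob r (mob (-r) A) = ((X 0 * X 1 * ell r) ^ 2) ^ n * A := by
  have h0 : ell (0 : k) = X 0 * X 1 := by simp [ell]
  conv_rhs => rw [← aeval_X₃ A]
  rw [← aeval_mul_wt hA, mob, mob, map_aeval₃, ← mob]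
  simp only [map_mul, mob_ell, add_neg_cancel, h0]
  simp only [mob, aeval_X, Matrix.cons_val]
  apply aeval_congr₃ <;> ring

theorem mob_sq {G : MvPolynomial (Fin 3) k} {δ : ℕ} (hG : G.IsHomogeneous δ) (r : k) :
    mob r (sq G) = ell r ^ δ * hat r G := by
  rw [sq, map_aeval₃, hat, ← aeval_mul₃ hG]
  simp only [map_pow, mob, aeval_X, Matrix.cons_val]
  apply aeval_congr₃ <;> ring

/-- The composition law of the shifts. The factor that splits off is the source of the extraneous
components of the double conchoid. -/
theorem mob_hat {G : MvPolynomial (Fin 3) k} {δ : ℕ} (hG : G.IsHomogeneous δ) (r r' : k) :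
    mob r (hat r' G) = (ell r ^ 3 * (X 0 * X 1)) ^ δ * hat (r + r') G := by
  rw [hat, map_aeval₃, hat, ← aeval_mul₃ hG]
  simp only [map_pow, map_mul, mob_ell]
  simp only [mob, aeval_X, Matrix.cons_val]
  apply aeval_congr₃ <;> ring

theorem hat_zero {G : MvPolynomial (Fin 3) k} {δ : ℕ} (hG : G.IsHomogeneous δ) :
    hat 0 G = (X 0 * X 1) ^ δ * sq G := by
  rw [hat, sq, ← aeval_mul₃ hG]
  simp [ell]

theorem isWeightedHomogeneous_hat {G : MvPolynomial (Fin 3) k} {δ : ℕ} (hG : G.IsHomogeneous δ)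
    (r : k) : IsWeightedHomogeneous wt (hat r G) (4 * δ) := by
  rw [isWeightedHomogeneous_iff_scale, hat, map_aeval₃]
  have h1 := aeval_mul₃ hG (Polynomial.X ^ 4 : Polynomial (MvPolynomial (Fin 3) k))
    (Polynomial.C (ell r * X 0 ^ 2)) (Polynomial.C (ell r * X 1 ^ 2))
    (Polynomial.C (X 0 * X 1 * X 2))
  have h2 := map_aeval₃ ((Algebra.ofId (MvPolynomial (Fin 3) k)
    (Polynomial (MvPolynomial (Fin 3) k))).restrictScalars k) (ell r * X 0 ^ 2) (ell r * X 1 ^ 2)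
    (X 0 * X 1 * X 2) G
  simp only [AlgHom.coe_restrictScalars', Algebra.ofId_apply, Polynomial.algebraMap_eq] at h2
  rw [h2, pow_mul, mul_comm (aeval _ _), ← h1]
  simp only [scale, map_mul, map_pow, ell, map_sub, aeval_X, aeval_C, Polynomial.algebraMap_apply,
    algebraMap_eq, Matrix.cons_val]
  apply aeval_congr₃ <;> ring

theorem ell_ne_zero (r : k) : ell r ≠ 0 := by
  intro h
  have := congrArg (eval ![1, 1, 0]) h
  simp [ell] at this

theorem hat_ne_zero {G : MvPolynomial (Fin 3) k} {δ : ℕ} (hG : G.IsHomogeneous δ) (h0 : G ≠ 0)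
    (r : k) : hat r G ≠ 0 := by
  intro h
  have h1 := mob_hat hG (-r) r
  rw [h, map_zero, neg_add_cancel, hat_zero hG] at h1
  have h2 : sq G ≠ 0 := (map_ne_zero_iff _ sq_injective).2 h0
  exact mul_ne_zero (pow_ne_zero _ (mul_ne_zero (pow_ne_zero _ (ell_ne_zero _))
    (mul_ne_zero (X_ne_zero _) (X_ne_zero _)))) (mul_ne_zero (pow_ne_zero _
    (mul_ne_zero (X_ne_zero _) (X_ne_zero _))) h2) h1.symm

theorem flip₀_hat {G : MvPolynomial (Fin 3) k} {δ : ℕ} (hG : G.IsHomogeneous δ) (r : k) :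
    flip₀ (hat r G) = (-1) ^ δ * hat (-r) G := by
  rw [hat, hat, map_aeval₃, ← aeval_mul₃ hG]
  simp only [flip₀, map_mul, map_pow, ell, map_sub, aeval_X, aeval_C, algebraMap_eq,
    Matrix.cons_val, C_neg]
  apply aeval_congr₃ <;> ring

theorem eval_axis {G : MvPolynomial (Fin 3) k} {δ : ℕ} (hG : G.IsHomogeneous δ) {S : Type*}
    [CommRing S] [Algebra k S] (s : S) :
    aeval ![s, 0, 0] G = s ^ δ * algebraMap k S (aeval ![(1 : k), 0, 0] G) ∧
    aeval ![0, s, 0] G = s ^ δ * algebraMap k S (aeval ![(0 : k), 1, 0] G) ∧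
    aeval ![0, 0, s] G = s ^ δ * algebraMap k S (aeval ![(0 : k), 0, 1] G) := by
  have h := fun a b c : k => map_aeval₃ (Algebra.ofId k S) a b c G
  simp only [Algebra.ofId_apply] at h
  simp only [h, ← aeval_mul₃ hG, map_zero, map_one, mul_zero, mul_one, and_self]

/-- On p = 0 the curve is evaluated at a multiple of (0, 1, 0), and on q = 0 at a multiple of (1, 0,
0). -/
theorem isRelPrime_X_hat {G : MvPolynomial (Fin 3) k} {δ : ℕ} (hG : G.IsHomogeneous δ) {r : k}
    (hr : r ≠ 0) (hx : aeval ![(1 : k), 0, 0] G ≠ 0) (hy : aeval ![(0 : k), 1, 0] G ≠ 0) :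
    IsRelPrime (X 0 * X 1) (hat r G) := by
  apply IsRelPrime.mul_left
  · rw [X_prime.irreducible.isRelPrime_iff_not_dvd]
    intro h
    have h1 := map_dvd (aeval ![(0 : k), 1, 1]) h
    have h2 : aeval ![(0 : k), 1, 1] (hat r G) = aeval ![0, -r, 0] G := by
      rw [hat, map_aeval₃]
      apply aeval_congr₃ <;> simp [ell]
    rw [h2, (eval_axis hG _).2.1, aeval_X, Matrix.cons_val_zero, zero_dvd_iff] at h1
    exact mul_ne_zero (pow_ne_zero _ (neg_ne_zero.2 hr)) hy h1
  · rw [X_prime.irreducible.isRelPrime_iff_not_dvd]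
    intro h
    have h1 := map_dvd (aeval ![(1 : k), 0, 1]) h
    have h2 : aeval ![(1 : k), 0, 1] (hat r G) = aeval ![-r, 0, 0] G := by
      rw [hat, map_aeval₃]
      apply aeval_congr₃ <;> simp [ell]
    rw [h2, (eval_axis hG _).1, aeval_X, Matrix.cons_val_one, Matrix.cons_val_zero, zero_dvd_iff] at h1
    exact mul_ne_zero (pow_ne_zero _ (neg_ne_zero.2 hr)) hx h1

theorem isRelPrime_X_ell {r : k} (hr : r ≠ 0) (j : Fin 3) : IsRelPrime (X j) (ell r) := by
  rw [X_prime.irreducible.isRelPrime_iff_not_dvd]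
  intro h
  have h0 := map_dvd (aeval ![(0 : k), 1, 1]) h
  have h1 := map_dvd (aeval ![(1 : k), 0, 1]) h
  have h2 := map_dvd (aeval ![(1 : k), 1, 0]) h
  fin_cases j <;> simp [ell, hr] at h0 h1 h2

/-- Modulo `ell r` the first two arguments of `G` vanish, which leaves `G` at (0, 0, pqz), a nonzero
constant times a monomial prime to `ell r`. -/
theorem isRelPrime_ell_hat {G : MvPolynomial (Fin 3) k} {δ : ℕ} (hG : G.IsHomogeneous δ) {r : k}
    (hr : r ≠ 0) (hz : aeval ![(0 : k), 0, 1] G ≠ 0) : IsRelPrime (ell r) (hat r G) := by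
  have h1 : ell r ∣ hat r G - (X 0 * X 1 * X 2) ^ δ * C (aeval ![(0 : k), 0, 1] G) := by
    rw [← Ideal.mem_span_singleton, ← Ideal.Quotient.eq, ← algebraMap_eq, ← (eval_axis hG _).2.2]
    have hφ := map_aeval₃ (Ideal.Quotient.mkₐ k (Ideal.span {ell r}))
    simp only [Ideal.Quotient.mkₐ_eq_mk] at hφ
    have h0 : Ideal.Quotient.mk (Ideal.span {ell r}) (ell r) = 0 :=
      Ideal.Quotient.eq_zero_iff_mem.2 (Ideal.mem_span_singleton_self _)
    rw [hat, hφ, hφ]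
    simp [h0]
  have h2 : IsRelPrime (ell r) ((X 0 * X 1 * X 2) ^ δ * C (aeval ![(0 : k), 0, 1] G)) := by
    have h3 := fun j => (isRelPrime_X_ell hr j).symm
    refine IsRelPrime.mul_right (IsRelPrime.pow_right (((h3 0).mul_right (h3 1)).mul_right (h3 2)))
      ((isUnit_iff_ne_zero.2 hz).map C).isRelPrime_right
  obtain ⟨Q, hQ⟩ := h1
  rw [sub_eq_iff_eq_add'] at hQ
  rw [hQ]
  intro d hd hd'
  exact h2 hd ((dvd_add_left (hd.mul_right Q)).1 hd')

/-- Restrict to the section `ell r = 0`, that is z = pq / r, and cancel (pq) ^ δ. At p = 1, q = 0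
what is left of `hat r G` vanishes, while `hat (-r) G` leaves 2 ^ δ times the nonzero value of `G`
at (1, 0, 0). -/
theorem not_hat_dvd_hat_neg (h2 : (2 : k) ≠ 0) {G : MvPolynomial (Fin 3) k} {δ : ℕ} (hδ : 1 ≤ δ)
    (hG : G.IsHomogeneous δ) {r : k} (hr : r ≠ 0) (hx : aeval ![(1 : k), 0, 0] G ≠ 0) :
    ¬ hat r G ∣ hat (-r) G := by
  rintro ⟨D, hD⟩
  let φ : MvPolynomial (Fin 3) k →ₐ[k] MvPolynomial (Fin 3) k :=
    aeval ![X 0, X 1, X 0 * X 1 * C r⁻¹]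
  have hC : (C r * C r⁻¹ : MvPolynomial (Fin 3) k) = 1 := by
    rw [← C_mul, mul_inv_cancel₀ hr, C_1]
  have hell : φ (ell r) = 0 := by
    simp only [φ, ell, map_sub, map_mul, aeval_X, aeval_C, algebraMap_eq, Matrix.cons_val]
    linear_combination (-(X 0 * X 1)) * hC
  have hell' : φ (ell (-r)) = 2 * (X 0 * X 1) := by
    simp only [φ, ell, map_sub, map_mul, aeval_X, aeval_C, algebraMap_eq, Matrix.cons_val, map_neg]
    linear_combination (X 0 * X 1) * hC
  have h1 := congrArg φ hD
  have h3 : φ (hat r G) = (X 0 * X 1) ^ δ * ((X 0 * X 1 * C r⁻¹) ^ δ * C (aeval ![(0 : k), 0, 1] G)) := by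
    rw [← algebraMap_eq, ← (eval_axis hG _).2.2, ← aeval_mul₃ hG, hat, map_aeval₃]
    apply aeval_congr₃
    · rw [map_mul, hell, zero_mul, mul_zero]
    · rw [map_mul, hell, zero_mul, mul_zero]
    · simp only [φ, map_mul, aeval_X, Matrix.cons_val, algebraMap_eq]
  have h4 : φ (hat (-r) G) = (X 0 * X 1) ^ δ *
      aeval ![2 * X 0 ^ 2, 2 * X 1 ^ 2, X 0 * X 1 * C r⁻¹] G := by
    rw [hat, map_aeval₃, ← aeval_mul₃ hG]
    simp only [map_mul, hell', map_pow]
    simp only [φ, aeval_X, Matrix.cons_val]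
    apply aeval_congr₃ <;> ring
  rw [map_mul, h3, h4, mul_assoc (_ ^ δ)] at h1
  have h5 := mul_left_cancel₀ (pow_ne_zero _ (mul_ne_zero (X_ne_zero _) (X_ne_zero _))) h1
  have h6 := congrArg (aeval ![(1 : k), 0, 0]) h5
  have h7 : aeval ![(1 : k), 0, 0] (aeval ![2 * X 0 ^ 2, 2 * X 1 ^ 2, X 0 * X 1 * C r⁻¹] G) =
      aeval ![(2 : k), 0, 0] G := by
    rw [map_aeval₃]
    apply aeval_congr₃ <;> simp
  have h8 : aeval ![(1 : k), 0, 0] ((X 0 * X 1 * C r⁻¹ : MvPolynomial (Fin 3) k) ^ δ) = 0 := by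
    rw [map_pow]
    simp
    omega
  rw [h7, (eval_axis hG _).1, map_mul, map_mul, h8, zero_mul, zero_mul] at h6
  exact mul_ne_zero (pow_ne_zero δ h2) hx h6

/-- The map of the cone that adds `r` to the distance from `A` preserves irreducibility. -/
theorem irreducible_hat {G : MvPolynomial (Fin 3) k} {δ : ℕ} (hδ : 1 ≤ δ)
    (hG : G.IsHomogeneous δ) (hirr : Irreducible (sq G)) {r : k} (hr : r ≠ 0)
    (hx : aeval ![(1 : k), 0, 0] G ≠ 0) (hy : aeval ![(0 : k), 1, 0] G ≠ 0)
    (hz : aeval ![(0 : k), 0, 1] G ≠ 0) : Irreducible (hat r G) := by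
  have hG0 : G ≠ 0 := by rintro rfl; exact hirr.ne_zero (map_zero _)
  have hH0 := hat_ne_zero hG hG0 r
  -- Shifting back by `mob r` returns `A` up to factors prime to `hat r G`, so `hat r G` divides
  -- `A`.
  have key : ∀ A B, hat r G = A * B → sq G ∣ mob (-r) A → IsUnit B := by
    intro A B hAB hdvd
    obtain ⟨a, -, -, ha, -⟩ := exists_isWeightedHomogeneous_of_mul (w := wt) (n := 4 * δ)
      (hAB ▸ isWeightedHomogeneous_hat hG r) (hAB ▸ hH0)
    have h1 := map_dvd (mob r) hdvd
    rw [mob_mob ha, mob_sq hG] at h1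
    have h2 : IsRelPrime (hat r G) (((X 0 * X 1 * ell r) ^ 2) ^ a) :=
      IsRelPrime.pow_right (IsRelPrime.pow_right ((isRelPrime_X_hat hG hr hx hy).symm.mul_right
        (isRelPrime_ell_hat hG hr hz).symm))
    obtain ⟨Q, hQ⟩ := h2.dvd_of_dvd_mul_left ((dvd_mul_left _ _).trans h1)
    have hA0 : A ≠ 0 := left_ne_zero_of_mul (hAB ▸ hH0)
    refine IsUnit.of_mul_eq_one Q (mul_left_cancel₀ hA0 ?_)
    rw [← mul_assoc, ← hAB, ← hQ, mul_one]
  refine ⟨fun hu => ?_, fun A B hAB => ?_⟩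
  -- Since `δ ≥ 1`, the polynomial vanishes at the origin and is not a unit.
  · have h1 := hu.map (aeval ![(0 : k), 0, 0])
    rw [hat, map_aeval₃] at h1
    have h2 := (eval_axis hG (0 : k)).1
    rw [zero_pow (by omega), zero_mul] at h2
    simp [ell] at h1
    simp at h2
    exact h1 h2
  · have h1 : sq G ∣ mob (-r) A * mob (-r) B := by
      rw [← map_mul, ← hAB, mob_hat hG, neg_add_cancel, hat_zero hG]
      exact (dvd_mul_left _ _).mul_left _
    rcases hirr.prime.dvd_or_dvd h1 with h | h
    · exact Or.inr (key A B hAB h)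
    · exact Or.inl (key B A (by rw [hAB, mul_comm]) h)

/-- The image in the plane of an irreducible curve of the cone that is not invariant. -/
theorem irreducible_of_sq_eq {P Q : MvPolynomial (Fin 3) k} (hP : Irreducible P)
    (hQ : Associated (flip₀ P) Q) (hPQ : ¬ P ∣ Q) {D : MvPolynomial (Fin 3) k}
    (hD : sq D = P * Q) : Irreducible D := by
  have hQ' : Prime Q := (hQ.irreducible (irreducible_flip₀ hP)).prime
  -- A pull-back divisible by `P` is also divisible by the conjugate `Q`, hence by the whole
  -- product.
  have key : ∀ A B, D = A * B → P ∣ sq A → IsUnit B := by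
    intro A B hAB hdvd
    have h1 := map_dvd flip₀ hdvd
    rw [flip₀_sq, hQ.dvd_iff_dvd_left] at h1
    obtain ⟨U, hU⟩ := hdvd
    have h2 : Q ∣ U := by
      rw [hU] at h1
      refine (hQ'.dvd_or_dvd h1).resolve_left fun h => hPQ ?_
      exact ((hQ'.irreducible.associated_of_dvd hP h).symm.dvd)
    obtain ⟨V, rfl⟩ := h2
    apply isUnit_of_isUnit_sq
    refine IsUnit.of_mul_eq_one V (mul_left_cancel₀ (mul_ne_zero hP.ne_zero hQ'.ne_zero) ?_)
    have h3 : sq A * sq B = P * Q := by rw [← map_mul, ← hAB, hD]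
    linear_combination h3 - sq B * hU
  refine ⟨fun hu => ?_, fun A B hAB => ?_⟩
  · have := hu.map sq
    rw [hD] at this
    exact hP.not_isUnit (isUnit_of_mul_isUnit_left this)
  · have h1 : P ∣ sq A * sq B := by
      rw [← map_mul, ← hAB, hD]
      exact dvd_mul_right _ _
    rcases hP.prime.dvd_or_dvd h1 with h | h
    · exact Or.inr (key A B hAB h)
    · exact Or.inl (key B A (by rw [hAB, mul_comm]) h)

end Conchoid

/-! ### The resultant for a circle and the double conchoid formula -/

section CircleConchoid

variable {k : Type*} [Field k]

theorem isHomogeneous_circle (r : k) : (circle r).IsHomogeneous 2 := by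
  refine ((isHomogeneous_X_pow 0 2).add (isHomogeneous_X_pow 1 2)).sub ?_
  exact (isHomogeneous_X_pow 2 2).C_mul _

theorem circle_ne_zero (r : k) : circle r ≠ 0 := by
  intro h
  have := congrArg (eval ![1, 0, 0]) h
  simp [circle] at this

theorem totalDegree_circle (r : k) : (circle r).totalDegree = 2 :=
  (isHomogeneous_circle r).totalDegree (circle_ne_zero r)

/-- The equation of a conchoid with respect to a circle, in terms of a square root `s` of
`x ^ 2 + y ^ 2`. -/
theorem map_conchoid_circle {K : Type*} [Field K] [Algebra k K] {G : MvPolynomial (Fin 3) k} {δ : ℕ}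
    (hG : G.IsHomogeneous δ) (h0 : G ≠ 0) (r : k) (φ : MvPolynomial (Fin 3) k →ₐ[k] K) {s : K}
    (hs : s ≠ 0) (hsq : s ^ 2 = φ (X 0) ^ 2 + φ (X 1) ^ 2) :
    φ (conchoid (circle r) G) =
      aeval ![(s - algebraMap k K r * φ (X 2)) * φ (X 0), (s - algebraMap k K r * φ (X 2)) * φ (X 1),
        s * φ (X 2)] G *
      aeval ![(s + algebraMap k K r * φ (X 2)) * φ (X 0), (s + algebraMap k K r * φ (X 2)) * φ (X 1),
        s * φ (X 2)] G := by
  set ρ := algebraMap k K r with hρ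
  -- The polynomial (1 - t)² s² - ρ² z² has the roots (s ∓ ρz) / s.
  have hf : Polynomial.mapAlgHom φ (aeval (R := k) ![(1 - Polynomial.X) * Polynomial.C (X 0),
      (1 - Polynomial.X) * Polynomial.C (X 1),
      (Polynomial.C (X 2) : Polynomial (MvPolynomial (Fin 3) k))] (circle r)) =
      Polynomial.C (s ^ 2) * ((Polynomial.X - Polynomial.C ((s - ρ * φ (X 2)) / s)) *
        (Polynomial.X - Polynomial.C ((s + ρ * φ (X 2)) / s))) := by
    have h1 : s * ((s - ρ * φ (X 2)) / s) = s - ρ * φ (X 2) := mul_div_cancel₀ _ hs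
    have h2 : s * ((s + ρ * φ (X 2)) / s) = s + ρ * φ (X 2) := mul_div_cancel₀ _ hs
    set t₁ := (s - ρ * φ (X 2)) / s
    set t₂ := (s + ρ * φ (X 2)) / s
    have h3 : Polynomial.C s * Polynomial.C t₁ = Polynomial.C s - Polynomial.C (ρ * φ (X 2)) := by
      rw [← Polynomial.C_mul, h1, Polynomial.C_sub]
    have h4 : Polynomial.C s * Polynomial.C t₂ = Polynomial.C s + Polynomial.C (ρ * φ (X 2)) := by
      rw [← Polynomial.C_mul, h2, Polynomial.C_add]
    have h5 := congrArg Polynomial.C hsq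
    have h6 : φ (C (r ^ 2)) = ρ ^ 2 := by
      rw [← algebraMap_eq, AlgHom.commutes, map_pow]
    rw [map_aeval₃]
    simp only [circle, map_sub, map_add, map_mul, map_pow, aeval_X, Matrix.cons_val,
      Polynomial.coe_mapAlgHom, Polynomial.map_one,
      Polynomial.map_X, Polynomial.map_C, aeval_C, RingHom.coe_coe] at h3 h4 h5 ⊢
    have h7 : algebraMap k (Polynomial K) r = Polynomial.C ρ := rfl
    rw [h7]
    linear_combination (Polynomial.C s * Polynomial.X - Polynomial.C s * Polynomial.C t₂) * h3 +
      (Polynomial.C s * Polynomial.X - Polynomial.C s + Polynomial.C ρ * Polynomial.C (φ (X 2))) * h4 -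
      (1 - Polynomial.X) ^ 2 * h5
  have hg : Polynomial.mapAlgHom φ (aeval (R := k) ![Polynomial.X * Polynomial.C (X 0),
      Polynomial.X * Polynomial.C (X 1),
      (Polynomial.C (X 2) : Polynomial (MvPolynomial (Fin 3) k))] G) =
      aeval ![Polynomial.X * Polynomial.C (φ (X 0)), Polynomial.X * Polynomial.C (φ (X 1)),
        Polynomial.C (φ (X 2))] G := by
    rw [map_aeval₃]
    simp
  -- The leading coefficient s² contributes s ^ (2δ) to the resultant. One factor s ^ δ clears the
  -- denominators at each root.
  have heval : ∀ t : K, s ^ δ * Polynomial.eval (t / s) (aeval ![Polynomial.X * Polynomial.C (φ (X 0)),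
      Polynomial.X * Polynomial.C (φ (X 1)), Polynomial.C (φ (X 2))] G) =
      aeval ![t * φ (X 0), t * φ (X 1), s * φ (X 2)] G := by
    intro t
    have h1 := map_aeval₃ ((Polynomial.aeval (t / s)).restrictScalars k)
      (Polynomial.X * Polynomial.C (φ (X 0))) (Polynomial.X * Polynomial.C (φ (X 1)))
      (Polynomial.C (φ (X 2))) G
    rw [AlgHom.restrictScalars_apply, Polynomial.coe_aeval_eq_eval] at h1
    rw [h1, ← aeval_mul₃ hG]
    have h2 : s * (t / s) = t := mul_div_cancel₀ _ hs
    apply aeval_congr₃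
    · simp
      linear_combination φ (X 0) * h2
    · simp
      linear_combination φ (X 1) * h2
    · simp
  -- The true degree may be smaller than the formal degree `δ`. The product formula for the
  -- resultant needs only this bound.
  have hdeg : (aeval ![Polynomial.X * Polynomial.C (φ (X 0)), Polynomial.X * Polynomial.C (φ (X 1)),
        Polynomial.C (φ (X 2))] G : Polynomial K).natDegree ≤ δ := by
    rw [← aeval_map_algebraMap K]
    refine (aeval_natDegree_le (m := δ) (n := 1) _ (hG.map _).totalDegree_le _ fun j => ?_).trans
      (mul_one δ).le
    fin_cases j
    · exact (Polynomial.natDegree_mul_C_le _ _).trans Polynomial.natDegree_X_le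
    · exact (Polynomial.natDegree_mul_C_le _ _).trans Polynomial.natDegree_X_le
    · simp
  rw [conchoid, totalDegree_circle, hG.totalDegree h0]
  change φ.toRingHom _ = _
  rw [← Polynomial.resultant_map_map]
  change Polynomial.resultant (Polynomial.mapAlgHom φ _) (Polynomial.mapAlgHom φ _) _ _ = _
  rw [hf, hg, Polynomial.resultant_C_mul_left]
  have hmul := Polynomial.resultant_mul_left (Polynomial.X - Polynomial.C ((s - ρ * φ (X 2)) / s))
    (Polynomial.X - Polynomial.C ((s + ρ * φ (X 2)) / s)) _ δ hdeg
  rw [Polynomial.natDegree_X_sub_C, Polynomial.natDegree_X_sub_C,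
    Polynomial.resultant_X_sub_C_left _ _ _ hdeg, Polynomial.resultant_X_sub_C_left _ _ _ hdeg, one_add_one_eq_two] at hmul
  rw [hmul, ← heval, ← heval]
  ring

/-- The coordinates `x + i y`, `x - i y`, `z`. -/
def lin (i : k) (h2 : (2 : k) ≠ 0) (hi : i ^ 2 = -1) :
    MvPolynomial (Fin 3) k ≃ₐ[k] MvPolynomial (Fin 3) k :=
  have h : (C i ^ 2 : MvPolynomial (Fin 3) k) = -1 := by rw [← C_pow, hi, C_neg, C_1]
  have h' : (2 * C 2⁻¹ : MvPolynomial (Fin 3) k) = 1 := by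
    rw [← map_ofNat C 2, ← C_mul, mul_inv_cancel₀ h2, C_1]
  AlgEquiv.ofAlgHom
    (aeval ![C 2⁻¹ * (X 0 + X 1), -(C i * C 2⁻¹) * (X 0 - X 1), X 2])
    (aeval ![X 0 + C i * X 1, X 0 - C i * X 1, X 2])
    (by
      apply MvPolynomial.algHom_ext
      intro j
      fin_cases j <;> simp only [AlgHom.comp_apply, AlgHom.id_apply, aeval_X, map_add, map_sub, map_mul, aeval_C,
        algebraMap_eq, Matrix.cons_val, Fin.zero_eta, Fin.mk_one, Fin.reduceFinMk]
      · linear_combination X 0 * h' - C 2⁻¹ * (X 0 - X 1) * h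
      · linear_combination X 1 * h' + C 2⁻¹ * (X 0 - X 1) * h)
    (by
      apply MvPolynomial.algHom_ext
      intro j
      fin_cases j <;> simp only [AlgHom.comp_apply, AlgHom.id_apply, aeval_X, map_add, map_sub, map_mul, map_neg,
        aeval_C, algebraMap_eq, Matrix.cons_val, Fin.zero_eta, Fin.mk_one, Fin.reduceFinMk]
      · linear_combination X 0 * h'
      · linear_combination X 1 * h' - 2 * C 2⁻¹ * X 1 * h)

variable {i : k} (h2 : (2 : k) ≠ 0) (hi : i ^ 2 = -1)

theorem lin_apply (G : MvPolynomial (Fin 3) k) : lin i h2 hi G =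
    aeval ![C 2⁻¹ * (X 0 + X 1), -(C i * C 2⁻¹) * (X 0 - X 1), X 2] G := rfl

theorem lin_symm_apply (G : MvPolynomial (Fin 3) k) : (lin i h2 hi).symm G =
    aeval ![X 0 + C i * X 1, X 0 - C i * X 1, X 2] G := rfl

theorem isHomogeneous_lin {G : MvPolynomial (Fin 3) k} {n : ℕ} :
    (lin i h2 hi G).IsHomogeneous n ↔ G.IsHomogeneous n := by
  have hX := fun j : Fin 3 => isHomogeneous_X k j
  constructor
  · intro h
    rw [← (lin i h2 hi).symm_apply_apply G, lin_symm_apply]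
    have := h.aeval (![X 0 + C i * X 1, X 0 - C i * X 1, X 2] : Fin 3 → MvPolynomial (Fin 3) k) (n := 1) (by
      intro j
      fin_cases j
      · exact (hX 0).add ((hX 1).C_mul _)
      · exact (hX 0).sub ((hX 1).C_mul _)
      · exact hX 2)
    rwa [one_mul] at this
  · intro h
    rw [lin_apply]
    have := h.aeval (![C 2⁻¹ * (X 0 + X 1), -(C i * C 2⁻¹) * (X 0 - X 1), X 2] :
      Fin 3 → MvPolynomial (Fin 3) k) (n := 1) (by
      intro j
      fin_cases j
      · exact ((hX 0).add (hX 1)).C_mul _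
      · change (-(C i * C 2⁻¹) * (X 0 - X 1) : MvPolynomial (Fin 3) k).IsHomogeneous 1
        rw [← C_mul, ← C_neg]
        exact ((hX 0).sub (hX 1)).C_mul _
      · exact hX 2)
    rwa [one_mul] at this

theorem sq_lin_conchoid {G : MvPolynomial (Fin 3) k} {δ : ℕ}
    (hG : G.IsHomogeneous δ) (h0 : G ≠ 0) (r : k) :
    sq (lin i h2 hi (conchoid (circle r) G)) =
      hat r (lin i h2 hi G) * hat (-r) (lin i h2 hi G) := by
  let K := FractionRing (MvPolynomial (Fin 3) k)
  let ψ : MvPolynomial (Fin 3) k →ₐ[k] K := IsScalarTower.toAlgHom k (MvPolynomial (Fin 3) k) K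
  have hψ : Function.Injective ψ := IsFractionRing.injective (MvPolynomial (Fin 3) k) K
  have h : (C i ^ 2 : MvPolynomial (Fin 3) k) = -1 := by rw [← C_pow, hi, C_neg, C_1]
  have h' : (2 * C 2⁻¹ : MvPolynomial (Fin 3) k) = 1 := by
    rw [← map_ofNat C 2, ← C_mul, mul_inv_cancel₀ h2, C_1]
  let φ : MvPolynomial (Fin 3) k →ₐ[k] MvPolynomial (Fin 3) k := sq.comp (lin i h2 hi).toAlgHom
  have hφ : ∀ A, φ A = sq (lin i h2 hi A) := fun _ => rfl
  have hX0 : φ (X 0) = C 2⁻¹ * (X 0 ^ 2 + X 1 ^ 2) := by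
    simp [hφ, lin_apply, sq, algebraMap_eq]
  have hX1 : φ (X 1) = -(C i * C 2⁻¹) * (X 0 ^ 2 - X 1 ^ 2) := by
    simp [hφ, lin_apply, sq, algebraMap_eq]
  have hX2 : φ (X 2) = X 2 := by
    simp [hφ, lin_apply, sq]
  have hsq : (X 0 * X 1) ^ 2 = φ (X 0) ^ 2 + φ (X 1) ^ 2 := by
    rw [hX0, hX1]
    linear_combination (-(C 2⁻¹ ^ 2) * (X 0 ^ 2 - X 1 ^ 2) ^ 2) * h -
      (X 0 * X 1) ^ 2 * (2 * C 2⁻¹ + 1) * h'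
  have hhat : ∀ r : k, hat r (lin i h2 hi G) =
      aeval ![ell r * φ (X 0), ell r * φ (X 1), X 0 * X 1 * X 2] G := by
    intro r
    rw [lin_apply, hat, map_aeval₃, hX0, hX1]
    apply aeval_congr₃
    · simp [algebraMap_eq]
      ring
    · simp [algebraMap_eq]
      ring
    · simp
  have hmain := map_conchoid_circle hG h0 r (ψ.comp φ) (s := ψ (X 0 * X 1))
    ((map_ne_zero_iff _ hψ).2 (mul_ne_zero (X_ne_zero _) (X_ne_zero _)))
    (by simp only [AlgHom.comp_apply, ← map_pow, ← map_add, hsq])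
  apply hψ
  rw [map_mul, hhat, hhat, map_aeval₃, map_aeval₃]
  change _ = _ at hmain
  refine hmain.trans ?_
  have hr : algebraMap k K r = ψ (C r) := (ψ.commutes r).symm
  rw [hr]
  simp only [AlgHom.comp_apply, hX2]
  congr 1
  · apply aeval_congr₃ <;> simp only [ell, map_mul, map_sub]
  · apply aeval_congr₃ <;> simp only [ell, map_mul, map_sub, map_neg] <;> ring

theorem conchoid_circle_ne_zero (h2 : (2 : k) ≠ 0) (hi : i ^ 2 = -1) {G : MvPolynomial (Fin 3) k} {δ : ℕ}
    (hG : G.IsHomogeneous δ) (h0 : G ≠ 0) (r : k) : conchoid (circle r) G ≠ 0 := by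
  intro h
  have h1 := sq_lin_conchoid h2 hi hG h0 r
  rw [h, map_zero, map_zero] at h1
  have h3 : lin i h2 hi G ≠ 0 := (map_ne_zero_iff _ (lin i h2 hi).injective).2 h0
  have h4 := (isHomogeneous_lin h2 hi).2 hG
  exact mul_ne_zero (hat_ne_zero h4 h3 _) (hat_ne_zero h4 h3 _) h1.symm

theorem isHomogeneous_conchoid_circle (h2 : (2 : k) ≠ 0) (hi : i ^ 2 = -1) {G : MvPolynomial (Fin 3) k} {δ : ℕ}
    (hG : G.IsHomogeneous δ) (h0 : G ≠ 0) (r : k) :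
    (conchoid (circle r) G).IsHomogeneous (4 * δ) := by
  have h4 := (isHomogeneous_lin h2 hi).2 hG
  rw [← isHomogeneous_lin h2 hi, ← isWeightedHomogeneous_sq_iff, sq_lin_conchoid h2 hi hG h0,
    show 2 * (4 * δ) = 4 * δ + 4 * δ by ring]
  exact (isWeightedHomogeneous_hat h4 _).mul (isWeightedHomogeneous_hat h4 _)

theorem lin_circle (r : k) : lin i h2 hi (circle r) = X 0 * X 1 - C (r ^ 2) * X 2 ^ 2 := by
  refine ((lin i h2 hi).symm_apply_eq.1 ?_).symm
  rw [lin_symm_apply]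
  have h : (C i ^ 2 : MvPolynomial (Fin 3) k) = -1 := by rw [← C_pow, hi, C_neg, C_1]
  simp only [circle, map_sub, map_mul, map_pow, aeval_X, aeval_C, algebraMap_eq, Matrix.cons_val]
  linear_combination (-X 1 ^ 2) * h

theorem lin_line : lin i h2 hi (lineThroughA 1 i) = C i * X 0 := by
  refine ((lin i h2 hi).symm_apply_eq.1 ?_).symm
  rw [lin_symm_apply]
  have h : (C i ^ 2 : MvPolynomial (Fin 3) k) = -1 := by rw [← C_pow, hi, C_neg, C_1]
  simp only [lineThroughA, map_mul, aeval_X, aeval_C, algebraMap_eq, Matrix.cons_val, C_1]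
  linear_combination X 1 * h

theorem lin_line_neg : lin i h2 hi (lineThroughA 1 (-i)) = -C i * X 1 := by
  refine ((lin i h2 hi).symm_apply_eq.1 ?_).symm
  rw [lin_symm_apply]
  have h : (C i ^ 2 : MvPolynomial (Fin 3) k) = -1 := by rw [← C_pow, hi, C_neg, C_1]
  simp only [lineThroughA, map_mul, map_neg, aeval_X, aeval_C, algebraMap_eq, Matrix.cons_val, C_1]
  linear_combination X 1 * h

/-- The curve in the cone that lies over the conchoid of a conchoid. -/
theorem hat_lin_conchoid {G : MvPolynomial (Fin 3) k} {δ : ℕ}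
    (hG : G.IsHomogeneous δ) (h0 : G ≠ 0) (r : k) :
    ∀ t, t = r ∨ t = -r → hat t (lin i h2 hi (conchoid (circle r) G)) =
      ell t ^ (2 * δ) * (X 0 * X 1) ^ (3 * δ) * sq (lin i h2 hi G) *
        hat (2 * t) (lin i h2 hi G) := by
  have h4 := (isHomogeneous_lin h2 hi).2 hG
  intro t ht
  have h5 := (isHomogeneous_lin h2 hi).2 (isHomogeneous_conchoid_circle h2 hi hG h0 r)
  -- The shift of the pulled-back conchoid is computed in two ways. The exponent of `ell t` is 6δ
  -- from the two factors less the 4δ cancelled. That of pq is 2δ from the shifts plus δ from `hat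
  -- 0`.
  have h6 := mob_sq h5 t
  have h7 : sq (lin i h2 hi (conchoid (circle r) G)) =
      hat t (lin i h2 hi G) * hat (-t) (lin i h2 hi G) := by
    rw [sq_lin_conchoid h2 hi hG h0]
    rcases ht with rfl | rfl
    · rfl
    · rw [neg_neg, mul_comm]
  rw [h7, map_mul, mob_hat h4, mob_hat h4, ← two_mul, add_neg_cancel, hat_zero h4] at h6
  refine mul_left_cancel₀ (pow_ne_zero (4 * δ) (ell_ne_zero t)) (h6.symm.trans ?_)
  ring

/-- The equation of the double conchoid. -/
theorem conchoid_conchoid (h2 : (2 : k) ≠ 0) (hi : i ^ 2 = -1) {G : MvPolynomial (Fin 3) k} {δ : ℕ}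
    (hG : G.IsHomogeneous δ) (h0 : G ≠ 0) (r : k) :
    conchoid (circle r) (conchoid (circle r) G) =
      circle r ^ (2 * δ) * (lineThroughA 1 i * lineThroughA 1 (-i)) ^ (3 * δ) * G ^ 2 *
        conchoid (circle (2 * r)) G := by
  apply (lin i h2 hi).injective
  apply sq_injective
  rw [sq_lin_conchoid h2 hi (isHomogeneous_conchoid_circle h2 hi hG h0 r)
    (conchoid_circle_ne_zero h2 hi hG h0 r), hat_lin_conchoid h2 hi hG h0 r _ (Or.inl rfl),
    hat_lin_conchoid h2 hi hG h0 r _ (Or.inr rfl)]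
  have h : (C i ^ 2 : MvPolynomial (Fin 3) k) = -1 := by rw [← C_pow, hi, C_neg, C_1]
  have hc : sq (lin i h2 hi (circle r)) = ell r * ell (-r) := by
    rw [lin_circle]
    simp only [sq, ell, map_mul, map_sub, map_neg, map_pow, aeval_X, aeval_C, algebraMap_eq, Matrix.cons_val]
    ring
  have hl : sq (lin i h2 hi (lineThroughA 1 i)) * sq (lin i h2 hi (lineThroughA 1 (-i))) =
      (X 0 * X 1) ^ 2 := by
    rw [lin_line, lin_line_neg]
    simp only [sq, map_mul, map_neg, aeval_X, aeval_C, algebraMap_eq, Matrix.cons_val]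
    linear_combination (-(X 0 ^ 2 * X 1 ^ 2)) * h
  simp only [map_mul, map_pow, sq_lin_conchoid h2 hi hG h0, hc, hl, mul_neg]
  ring

end CircleConchoid

/-! ### Divisors of products and of irreducible forms -/

section Divisors

variable {k : Type*} [Field k]

theorem divisor_apply (G : MvPolynomial (Fin 3) k) (E : IntegralCurve k) :
    divisor G E = (E.mult G : ℤ) := rfl

theorem divisor_mul {F G : MvPolynomial (Fin 3) k} (hF : F ≠ 0) (hG : G ≠ 0) :
    divisor (F * G) = divisor F + divisor G := by
  ext E
  have hE := E.irreducible_form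
  have h1 := FiniteMultiplicity.of_not_isUnit hE.not_isUnit hF
  have h2 := FiniteMultiplicity.of_not_isUnit hE.not_isUnit hG
  rw [Finsupp.add_apply, divisor_apply, divisor_apply, divisor_apply, IntegralCurve.mult,
    IntegralCurve.mult, IntegralCurve.mult, emultiplicity_mul hE.prime,
    ENat.toNat_add (finiteMultiplicity_iff_emultiplicity_ne_top.1 h1)
    (finiteMultiplicity_iff_emultiplicity_ne_top.1 h2), Nat.cast_add]

theorem divisor_one : divisor (1 : MvPolynomial (Fin 3) k) = 0 := by
  ext E
  rw [divisor_apply, IntegralCurve.mult, emultiplicity_eq_zero.2]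
  · simp
  · exact fun h => E.irreducible_form.not_isUnit (isUnit_of_dvd_one h)

theorem divisor_pow {F : MvPolynomial (Fin 3) k} (hF : F ≠ 0) (n : ℕ) :
    divisor (F ^ n) = n • divisor F := by
  induction n with
  | zero => rw [pow_zero, divisor_one, zero_smul]
  | succ n ih => rw [pow_succ, divisor_mul (pow_ne_zero _ hF) hF, ih, succ_nsmul]

/-- An irreducible form cuts out an integral curve, counted once. -/
theorem exists_divisor_eq_single {F : MvPolynomial (Fin 3) k} {n : ℕ} (hF : F.IsHomogeneous n)
    (hirr : Irreducible F) : ∃ E : IntegralCurve k, E.ideal = Ideal.span {F} ∧ E.degree = n ∧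
      divisor F = Finsupp.single E 1 := by
  classical
  let E : IntegralCurve k := ⟨Ideal.span {F}, F, n, hF, hirr, rfl⟩
  have hE : Associated E.form F := by
    rw [← Ideal.span_singleton_eq_span_singleton, ← E.ideal_eq]
  refine ⟨E, rfl, ?_, ?_⟩
  · obtain ⟨u, hu⟩ := hE.symm
    obtain ⟨c, hc, hc'⟩ := isUnit_iff_eq_C_of_isReduced.1 u.isUnit
    have h : E.form.IsHomogeneous n := by
      rw [← hu, hc', mul_comm]
      exact hF.C_mul c
    exact h.totalDegree E.irreducible_form.ne_zero
  · ext E'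
    rw [divisor_apply, Finsupp.single_apply, IntegralCurve.mult]
    split_ifs with h
    · subst h
      rw [emultiplicity_eq_of_associated_right hE.symm]
      have h1 := FiniteMultiplicity.of_not_isUnit E.irreducible_form.not_isUnit
        E.irreducible_form.ne_zero
      rw [h1.emultiplicity_self]
      rfl
    · rw [emultiplicity_eq_zero.2]
      · rfl
      · intro hdvd
        apply h
        ext1
        rw [E'.ideal_eq, Ideal.span_singleton_eq_span_singleton]
        exact (E'.irreducible_form.associated_of_dvd hirr hdvd).symm

theorem Divisor.degree_add (D D' : Divisor k) :
    (D + D').degree = D.degree + D'.degree := by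
  classical
  exact Finsupp.sum_add_index' (by simp) (by intros; ring)

theorem Divisor.degree_nsmul (n : ℕ) (D : Divisor k) : (n • D).degree = n * D.degree := by
  induction n with
  | zero => simp [Divisor.degree]
  | succ n ih => rw [succ_nsmul, Divisor.degree_add, ih]; push_cast; ring

theorem degree_divisor {F : MvPolynomial (Fin 3) k} {n : ℕ} (hF : F.IsHomogeneous n)
    (hirr : Irreducible F) : (divisor F).degree = n := by
  obtain ⟨E, -, hE, h⟩ := exists_divisor_eq_single hF hirr
  rw [h, Divisor.degree, Finsupp.sum_single_index (by simp), hE, one_mul]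

theorem isIntegral_divisor {F : MvPolynomial (Fin 3) k} {n : ℕ} (hF : F.IsHomogeneous n)
    (hirr : Irreducible F) : (divisor F).IsIntegral := by
  obtain ⟨E, -, -, h⟩ := exists_divisor_eq_single hF hirr
  exact ⟨E, h⟩

theorem dvd_of_divisor_eq {F G : MvPolynomial (Fin 3) k} {m n : ℕ} (hF : F.IsHomogeneous m)
    (hF' : Irreducible F) (hG : G.IsHomogeneous n) (hG' : Irreducible G)
    (h : divisor F = divisor G) : F ∣ G := by
  obtain ⟨E, hE, -, h1⟩ := exists_divisor_eq_single hF hF'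
  obtain ⟨E', hE', -, h2⟩ := exists_divisor_eq_single hG hG'
  rw [h1, h2, Finsupp.single_left_inj one_ne_zero] at h
  rw [h, hE', Ideal.span_singleton_eq_span_singleton] at hE
  exact hE.symm.dvd

end Divisors

/-! ### Integrality of the components -/

section Components

variable {k : Type*} [Field k] {i : k}

theorem irreducible_lin_iff (h2 : (2 : k) ≠ 0) (hi : i ^ 2 = -1) {G : MvPolynomial (Fin 3) k} :
    Irreducible (lin i h2 hi G) ↔ Irreducible G :=
  MulEquiv.irreducible_iff (lin i h2 hi)

theorem ne_zero_of_sq_eq_neg_one (hi : i ^ 2 = -1) : i ≠ 0 := by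
  rintro rfl
  simp at hi

theorem irreducible_circle (h2 : (2 : k) ≠ 0) (hi : i ^ 2 = -1) {r : k} (hr : r ≠ 0) :
    Irreducible (circle r) := by
  rw [← irreducible_lin_iff h2 hi, lin_circle]
  -- In the coordinates u, v, z the circle is uv - r²z², linear in u with coprime coefficients.
  have h := irreducible_mul_X_add (X 1) (-(C (r ^ 2) * X 2 ^ 2)) (0 : Fin 3) (X_ne_zero (R := k) 1)
    (by simp [vars_X]) (by
      intro h
      rw [vars_neg, vars_C_mul _ (pow_ne_zero 2 hr)] at h
      simpa [vars_X] using vars_pow _ _ h) (by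
      rw [X_prime.irreducible.isRelPrime_iff_not_dvd]
      intro h
      have := map_dvd (eval ![1, 0, 1]) h
      simp [hr] at this)
  rwa [mul_comm, ← sub_eq_add_neg] at h

theorem isHomogeneous_line (a b : k) : (lineThroughA a b).IsHomogeneous 1 :=
  (isHomogeneous_C_mul_X _ _).sub (isHomogeneous_C_mul_X _ _)

theorem irreducible_line (h2 : (2 : k) ≠ 0) (hi : i ^ 2 = -1) :
    Irreducible (lineThroughA 1 i) ∧ Irreducible (lineThroughA 1 (-i)) := by
  have hu := (isUnit_iff_ne_zero.2 (ne_zero_of_sq_eq_neg_one hi)).map (C (σ := Fin 3))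
  constructor
  · rw [← irreducible_lin_iff h2 hi, lin_line, irreducible_isUnit_mul hu]
    exact X_prime.irreducible
  · rw [← irreducible_lin_iff h2 hi, lin_line_neg, irreducible_isUnit_mul hu.neg]
    exact X_prime.irreducible

/-- The two points at infinity are (1, 0, 0) and (0, 1, 0) in the coordinates u, v, z, and `hsq`
concerns the branch line u = 0. -/
theorem irreducible_conchoid_circle (h2 : (2 : k) ≠ 0) (hi : i ^ 2 = -1) {r : k} (hr : r ≠ 0)
    {G : MvPolynomial (Fin 3) k} {δ : ℕ} (hδ : 1 ≤ δ) (hG : G.IsHomogeneous δ)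
    (hirr : Irreducible G) (hx : eval ![2⁻¹, -(i * 2⁻¹), 0] G ≠ 0)
    (hy : eval ![2⁻¹, i * 2⁻¹, 0] G ≠ 0) (hz : eval ![0, 0, 1] G ≠ 0)
    (hsq : ∀ (c : k) (w : Polynomial k), aeval ![Polynomial.C 2⁻¹, Polynomial.C (i * 2⁻¹),
      Polynomial.X] G ≠ Polynomial.C c * w ^ 2) : Irreducible (conchoid (circle r) G) := by
  have hG' := (isHomogeneous_lin h2 hi).2 hG
  have hlin : ∀ {S : Type _} [CommRing S] [Algebra k S] (a b c : S), aeval ![a, b, c] (lin i h2 hi G) =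
      aeval ![algebraMap k S 2⁻¹ * (a + b), -(algebraMap k S i * algebraMap k S 2⁻¹) * (a - b), c] G := by
    intro S _ _ a b c
    rw [lin_apply, map_aeval₃]
    apply aeval_congr₃ <;> simp
  have hx' : aeval ![(1 : k), 0, 0] (lin i h2 hi G) ≠ 0 := by
    rw [hlin, aeval_eq_eval]
    simpa using hx
  have hy' : aeval ![(0 : k), 1, 0] (lin i h2 hi G) ≠ 0 := by
    rw [hlin, aeval_eq_eval]
    simpa using hy
  have hz' : aeval ![(0 : k), 0, 1] (lin i h2 hi G) ≠ 0 := by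
    rw [hlin, aeval_eq_eval]
    simpa using hz
  have hsq' : ∀ (c : k) (w : Polynomial k),
      aeval ![0, 1, Polynomial.X] (lin i h2 hi G) ≠ Polynomial.C c * w ^ 2 := by
    intro c w h
    apply hsq c w
    rw [← h, hlin]
    apply aeval_congr₃ <;> simp [Polynomial.algebraMap_eq]
  have hE := irreducible_sq h2 hG' ((irreducible_lin_iff h2 hi).2 hirr) hx' hy' hsq'
  have hH := irreducible_hat hδ hG' hE hr hx' hy' hz'
  rw [← irreducible_lin_iff h2 hi]
  refine irreducible_of_sq_eq hH (Q := hat (-r) (lin i h2 hi G)) ?_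
    (not_hat_dvd_hat_neg h2 hδ hG' hr hx') (sq_lin_conchoid h2 hi hG hirr.ne_zero r)
  rw [flip₀_hat hG']
  exact associated_unit_mul_left _ _ (isUnit_one.neg.pow _)

end Components

end PlaneConchoid

end

/-! ### The main theorem -/

open PlaneConchoid in
theorem mainTheorem8 {k : Type*} [Field k] (h2 : (2 : k) ≠ 0) (i : k) (hi : i ^ 2 = -1)
    (r : k) (hr : r ≠ 0) (δ : ℕ) (hδ : 1 ≤ δ) :
    ForGenericCurve k δ fun G =>
      (divisor (conchoid (circle r) (conchoid (circle r) G))).degree = 16 * δ ∧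
      divisor (conchoid (circle r) (conchoid (circle r) G)) =
        (2 * δ) • divisor (circle r) +
          (3 * δ) • (divisor (lineThroughA 1 i) + divisor (lineThroughA 1 (-i))) +
          2 • divisor G + divisor (conchoid (circle (2 * r)) G) ∧
      (divisor (conchoid (circle (2 * r)) G)).degree = 4 * δ ∧
      (∀ D ∈ [divisor (circle r), divisor (lineThroughA 1 i), divisor (lineThroughA 1 (-i)),
        divisor G, divisor (conchoid (circle (2 * r)) G)], D.IsIntegral) ∧
      [divisor (circle r), divisor (lineThroughA 1 i), divisor (lineThroughA 1 (-i)),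
        divisor G, divisor (conchoid (circle (2 * r)) G)].Nodup := by
  have hi0 := ne_zero_of_sq_eq_neg_one hi
  have h2' : (2 : k)⁻¹ ≠ 0 := inv_ne_zero h2
  have hpoint : ∀ y : k, ![(2 : k)⁻¹, y, 0] ≠ 0 := fun y h => h2' (congrFun h 0)
  refine (((forGenericCurve_irreducible hδ).and (forGenericCurve_ne_sq hδ h2' (i * 2⁻¹))).and
    ((forGenericCurve_eval_ne_zero (hpoint (-(i * 2⁻¹)))).and
      (forGenericCurve_eval_ne_zero (hpoint (i * 2⁻¹))))).mono ?_
  rintro G hG0 hG ⟨⟨⟨hirr, hz⟩, hsq⟩, hx, hy⟩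
  have hB := irreducible_circle h2 hi hr
  obtain ⟨hL, hL'⟩ := irreducible_line h2 hi
  have hBh := isHomogeneous_circle r
  have hLh := isHomogeneous_line 1 i
  have hLh' := isHomogeneous_line 1 (-i)
  have hC := irreducible_conchoid_circle h2 hi (mul_ne_zero h2 hr) hδ hG hirr hx hy hz
    fun c w h => hz (hsq c w h)
  have hCh := isHomogeneous_conchoid_circle h2 hi hG hG0 (2 * r)
  have hdiv : divisor (conchoid (circle r) (conchoid (circle r) G)) =
        (2 * δ) • divisor (circle r) +
          (3 * δ) • (divisor (lineThroughA 1 i) + divisor (lineThroughA 1 (-i))) +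
          2 • divisor G + divisor (conchoid (circle (2 * r)) G) := by
    have hLL := mul_ne_zero hL.ne_zero hL'.ne_zero
    have h1 := pow_ne_zero (2 * δ) hB.ne_zero
    have h3 := mul_ne_zero h1 (pow_ne_zero (3 * δ) hLL)
    have h4 := pow_ne_zero 2 hG0
    rw [conchoid_conchoid h2 hi hG hG0, divisor_mul (mul_ne_zero h3 h4) hC.ne_zero,
      divisor_mul h3 h4, divisor_mul h1 (pow_ne_zero _ hLL), divisor_pow hB.ne_zero,
      divisor_pow hLL, divisor_pow hG0, divisor_mul hL.ne_zero hL'.ne_zero]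
  have dB := degree_divisor hBh hB
  have dL := degree_divisor hLh hL
  have dL' := degree_divisor hLh' hL'
  have dG := degree_divisor hG hirr
  have dC := degree_divisor hCh hC
  push_cast at dB dL dL' dG dC
  refine ⟨?_, hdiv, dC, ?_, ?_⟩
  · rw [hdiv]
    simp only [Divisor.degree_add, Divisor.degree_nsmul, dB, dL, dL', dG, dC]
    push_cast
    ring
  · simp only [List.forall_mem_cons, List.not_mem_nil, false_implies, implies_true, and_true]
    exact ⟨isIntegral_divisor hBh hB, isIntegral_divisor hLh hL, isIntegral_divisor hLh' hL',
      isIntegral_divisor hG hirr, isIntegral_divisor hCh hC⟩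
  · have hline : ∀ a b : k, ¬ lineThroughA a b ∣ G := fun a b h => by
      have h1 := map_dvd (MvPolynomial.eval ![0, 0, 1]) h
      simp [lineThroughA] at h1
      exact hz h1
    -- The circle passes through a point at infinity where `G` does not vanish.
    have hcirc : ¬ circle r ∣ G := fun h => by
      have h1 := map_dvd (MvPolynomial.eval ![2⁻¹, i * 2⁻¹, 0]) h
      have h3 : MvPolynomial.eval ![2⁻¹, i * 2⁻¹, 0] (circle r) = 0 := by
        simp [circle, mul_pow, hi]
      rw [h3, zero_dvd_iff] at h1
      exact hy h1
    have hlines : ¬ lineThroughA 1 i ∣ lineThroughA 1 (-i) := fun h => by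
      have h1 := map_dvd (MvPolynomial.eval ![1, i, 0]) h
      simp [lineThroughA] at h1
      have h3 : (2 : k) * i = 0 := by linear_combination -h1
      exact mul_ne_zero h2 hi0 h3
    simp only [List.nodup_cons, List.mem_cons, List.not_mem_nil, or_false, not_or,
      not_false_eq_true, List.nodup_nil, and_true]
    -- Pairs involving C₂, and B with a line, differ in degree. The other pairs are separated by
    -- nondivisibility.
    refine ⟨⟨?_, ?_, ?_, ?_⟩, ⟨?_, ?_, ?_⟩, ⟨?_, ?_⟩, ?_⟩
    · exact fun h => by rw [h, dL] at dB; omega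
    · exact fun h => by rw [h, dL'] at dB; omega
    · exact fun h => hcirc (dvd_of_divisor_eq hBh hB hG hirr h)
    · exact fun h => by rw [h, dC] at dB; omega
    · exact fun h => hlines (dvd_of_divisor_eq hLh hL hLh' hL' h)
    · exact fun h => hline _ _ (dvd_of_divisor_eq hLh hL hG hirr h)
    · exact fun h => by rw [h, dC] at dL; omega
    · exact fun h => hline _ _ (dvd_of_divisor_eq hLh' hL' hG hirr h)
    · exact fun h => by rw [h, dC] at dL'; omega
    · exact fun h => by rw [h, dC] at dG; omega
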